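/- **Setting.** Let $W$ be a binary-input memoryless channel with output alphabet $\mathcal Y$ (a measurable space; for discrete $\mathcal Y$ all laws below are given by sums), symmetric via a measurable permutation $\pi$ of $\mathcal Y$ with $\pi\circ\pi=\mathrm{id}$ that maps the output law under input $0$ to that under input $1$. Let $\lambda:\mathcal Y\to\mathbb R$ be a fair labeler: $\lambda$ is measurable, $\lambda(\pi(y))=-\lambda(y)$, and for every Borel set $B\subseteq(0,\infty)$ one has $W(\lambda\in B\mid 0)\ge W(\lambda\in -B\mid 0)$, with strict inequality for some $B$. (When $\lambda$ takes countably many values this says that $\alpha_t\ge\alpha_{-t}$ for all $t>0$, strictly for some $t$, where $\alpha_t=W(\lambda=t\mid 0)$.) **Polar codes and min-sum decoding.** For $N=2^n$, the polar transform $x=x(u)$ of $u\in\{0,1\}^N$ is defined recursively: the first half of $x$ is the transform of $(u_{2k}\oplus u_{2k+1})_k$ and the second half is the transform of $(u_{2k+1})_k$, with $x=u$ if $N=1$. Put $\tilde f(a,b)=\operatorname{sign}(a)\operatorname{sign}(b)\min\{|a|,|b|\}$ and $g_u(a,b)=(-1)^ua+b$. The min-sum labels $\tilde L_N^{(i)}(y_0^{N-1},u_0^{i-1})$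 are given by $\tilde L_1^{(0)}(y)=\lambda(y)$, $\tilde L_N^{(2j)}=\tilde f(a,b)$, $\tilde L_N^{(2j+1)}=g_{u_{2j}}(a,b)$, where $$a=\tilde L_{N/2}^{(j)}\big(y_0^{N/2-1},(u_{2k}\oplus u_{2k+1})_{k<j}\big),\qquad b=\tilde L_{N/2}^{(j)}\big(y_{N/2}^{N-1},(u_{2k+1})_{k<j}\big).$$ The polar code of length $N$ with non-frozen set $\mathcal A\subseteq\{0,\dots,N-1\}$ has rate $|\mathcal A|/N$; its frozen bits are $0$, its other bits are uniform, and $x(u)$ is sent over $N$ independent uses of $W$. The min-sum successive-cancellation decoder sets, for $i=0,1,\dots,N-1$, $\hat u_i=1$ if $i\in\mathcal A$ and $\tilde L_N^{(i)}(y_0^{N-1},\hat u_0^{i-1})<0$, and $\hat u_i=0$ otherwise. Its word error probability is $\Pr(\hat u\ne u)$. **Synthetic distributions.** For $U$ uniform on $\{0,1\}^N$ and $Y_0^{N-1}$ the channel outputs when $x(U)$ is sent, let $\tilde Q_N^{(i)}(\cdot\,;b)$ be the measure $B\mapsto\Pr(\tilde L_N^{(i)}(Y_0^{N-1},U_0^{i-1})\in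 B,\ U_i=b)$, and put $$Z^\star(\tilde Q_N^{(i)})=\inf_{0<\xi\le1}2\int\xi^t\,\tilde Q_N^{(i)}(dt;0).$$ **Valid pairs.** Consider a finite full binary tree whose vertices are pairs $(d,j)$, $0\le j<2^d$, with root $(0,0)$, where $(d,j)$ has either no children or the two children $(d+1,2j)$ and $(d+1,2j+1)$. A pair $(\mathcal G,\mathcal E)$ is valid if, for some such tree, $\mathcal E$ is its set of leaves and $\mathcal G$ is a set of its vertices such that every path from the root to a leaf contains exactly one vertex of $\mathcal G$. Put $\zeta_{2^d}^{(j)}=Z^\star(\tilde Q_{2^d}^{(j)})$ for $(d,j)\in\mathcal G$, and below $\mathcal G$ recursively $\zeta_{2^{d+1}}^{(2j)}=2\zeta_{2^d}^{(j)}$ and $\zeta_{2^{d+1}}^{(2j+1)}=(\zeta_{2^d}^{(j)})^2$. With $\delta'(\eta)=2(8\eta)^{\log_2\varphi}$ and $\varphi=(1+\sqrt5)/2$, let $$R_{\mathrm L}(\mathcal G,\mathcal E)=\sum_{(d,j)\in\mathcal E}2^{-d}\max\{1-\delta'(\zeta_{2^d}^{(j)}),0\}.$$ **Proposition.** For every valid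 pair $(\mathcal G,\mathcal E)$, the number $R_{\mathrm L}(\mathcal G,\mathcal E)$ is a valid lower rate threshold under min-sum successive-cancellation decoding, that is: 1. For all $0<\beta<\frac12$ and $R<R_{\mathrm L}(\mathcal G,\mathcal E)$ there is $n_0$ such that for every $n\ge n_0$ there is a polar code of length $N=2^n$ whose rate is at least $R$ and whose word error probability is at most $2^{-N^\beta}$. 2. $R_{\mathrm L}(\mathcal G,\mathcal E)\le R_{\mathrm U}$ for every valid upper threshold $R_{\mathrm U}$, i.e. every real $R_{\mathrm U}$ such that for each $R>R_{\mathrm U}$ and $\varepsilon>0$, for all sufficiently large $n$, every polar code of length $2^n$ and rate at least $R$ has word error probability at least $1-\varepsilon$. -/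

import Mathlib

open MeasureTheory
open scoped ENNReal BigOperators

namespace MinSumPolar

noncomputable section

/-! ### Channels and labelers

A binary-input channel with output alphabet `Y` is a family `W x` (`x : ZMod 2`) of probability
measures on `Y`.  Channels with a discrete output alphabet are the case where `Y` carries the
discrete sigma-algebra. -/

/-- `σ` is a symmetry of the channel `W`: a (measurable) permutation of the output alphabet with
`σ (σ y) = y` that exchanges the two output laws.  For discrete `Y` the last condition says
`W(y | 1) = W(σ y | 0)`. -/
structure IsChannelSymmetry {Y : Type*} [MeasurableSpace Y] (W : ZMod 2 → Measure Y)
    (σ : Y → Y) : Prop where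
  measurable : Measurable σ
  involutive : Function.Involutive σ
  map_eq : (W 0).map σ = W 1

/-- Fair labeler: a real labeler which is odd with respect to the channel symmetry and sign
consistent.  Sign consistency is stated for sets `B` of positive labels, with `-B` the set of the
opposite labels; when the label takes countably many values this is equivalent to
`α t ≥ α (-t)` for all `t > 0`, with strict inequality for at least one `t`, where `α t` is the
probability of the label `t` under input `0`. -/
structure IsFairLabeler {Y : Type*} [MeasurableSpace Y] (W : ZMod 2 → Measure Y)
    (σ : Y → Y) (lab : Y → ℝ) : Prop where
  measurable : Measurable lab
  symm : ∀ y, lab (σ y) = -lab y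
  sign_le : ∀ B : Set ℝ, MeasurableSet B → B ⊆ Set.Ioi 0 →
    W 0 {y | -lab y ∈ B} ≤ W 0 {y | lab y ∈ B}
  sign_lt : ∃ B : Set ℝ, MeasurableSet B ∧ B ⊆ Set.Ioi 0 ∧
    W 0 {y | -lab y ∈ B} < W 0 {y | lab y ∈ B}

/-! ### The polar transform -/

/-- The first half of a vector of length `2 ^ (n + 1)`. -/
def firstHalf {α : Type*} {n : ℕ} (y : Fin (2 ^ (n + 1)) → α) : Fin (2 ^ n) → α :=
  fun k => y ⟨k, by have := k.2; rw [pow_succ]; omega⟩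

/-- The second half of a vector of length `2 ^ (n + 1)`. -/
def secondHalf {α : Type*} {n : ℕ} (y : Fin (2 ^ (n + 1)) → α) : Fin (2 ^ n) → α :=
  fun k => y ⟨2 ^ n + k, by have := k.2; rw [pow_succ]; omega⟩

/-- The entries with even index. -/
def evens {α : Type*} {n : ℕ} (u : Fin (2 ^ (n + 1)) → α) : Fin (2 ^ n) → α :=
  fun k => u ⟨2 * k, by have := k.2; rw [pow_succ]; omega⟩

/-- The entries with odd index. -/
def odds {α : Type*} {n : ℕ} (u : Fin (2 ^ (n + 1)) → α) : Fin (2 ^ n) → α :=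
  fun k => u ⟨2 * k + 1, by have := k.2; rw [pow_succ]; omega⟩

/-- The index `⌊i / 2⌋` one level up. -/
def halfIndex {n : ℕ} (i : Fin (2 ^ (n + 1))) : Fin (2 ^ n) :=
  ⟨i / 2, by have := i.2; have := pow_succ 2 n; omega⟩

/-- Arikan's polar transform of length `2 ^ n` over GF(2): the first half of the codeword is the
transform of the sum of the even and odd parts of `u`, the second half is the transform of the
odd part. -/
def polarTransform : (n : ℕ) → (Fin (2 ^ n) → ZMod 2) → Fin (2 ^ n) → ZMod 2
  | 0, u => u
  | n + 1, u => fun k =>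
      if h : (k : ℕ) < 2 ^ n then polarTransform n (evens u + odds u) ⟨k, h⟩
      else polarTransform n (odds u)
        ⟨k - 2 ^ n, by have := k.2; have := pow_succ 2 n; omega⟩

/-! ### Min-sum labels and synthetic distributions -/

/-- The min-sum function `sign a * sign b * min |a| |b|`. -/
def minSumF (a b : ℝ) : ℝ := Real.sign a * Real.sign b * min |a| |b|

/-- `g_u(a, b) = (-1)^u * a + b`. -/
def gFun (u : ZMod 2) (a b : ℝ) : ℝ := (-1) ^ u.val * a + b

/-- The min-sum label of the synthetic channel of index `i` at length `2 ^ n`, given the channel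
outputs `y` and the bits `u_0, ..., u_{i-1}`.  The entries of `u` with index at least `i` are not
used (see `minSumLabel_congr`). -/
def minSumLabel {Y : Type*} (lab : Y → ℝ) :
    (n : ℕ) → Fin (2 ^ n) → (Fin (2 ^ n) → Y) → (Fin (2 ^ n) → ZMod 2) → ℝ
  | 0, _, y, _ => lab (y 0)
  | n + 1, i, y, u =>
      let a := minSumLabel lab n (halfIndex i) (firstHalf y) (evens u + odds u)
      let b := minSumLabel lab n (halfIndex i) (secondHalf y) (odds u)
      if (i : ℕ) % 2 = 0 then minSumF a b
      else gFun (u ⟨i - 1, by have := i.2; omega⟩) a b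

theorem minSumLabel_congr {Y : Type*} (lab : Y → ℝ) (n : ℕ) (i : Fin (2 ^ n))
    (y : Fin (2 ^ n) → Y) (u u' : Fin (2 ^ n) → ZMod 2) (h : ∀ k, k < i → u k = u' k) :
    minSumLabel lab n i y u = minSumLabel lab n i y u' := by
  induction n with
  | zero => rfl
  | succ n ih =>
    have hodd : ∀ k, k < halfIndex i → odds u k = odds u' k := by
      intro k hk
      apply h
      simp only [halfIndex, Fin.lt_def] at hk ⊢
      omega
    have heven : ∀ k, k < halfIndex i → evens u k = evens u' k := by
      intro k hk
      apply h
      simp only [halfIndex, Fin.lt_def] at hk ⊢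
      omega
    have h1 := ih (halfIndex i) (firstHalf y) (evens u + odds u) (evens u' + odds u') (by
      intro k hk
      simp [heven k hk, hodd k hk])
    have h2 := ih (halfIndex i) (secondHalf y) (odds u) (odds u') hodd
    simp only [minSumLabel, h1, h2]
    split_ifs with hi
    · rfl
    · rw [h ⟨i - 1, by have := i.2; omega⟩ (by simp only [Fin.lt_def]; omega)]

/-- The law of the outputs of `2 ^ n` independent uses of the channel `W` when the polar transform
of `u` is sent. -/
def outputLaw {Y : Type*} [MeasurableSpace Y] (W : ZMod 2 → Measure Y) (n : ℕ)
    (u : Fin (2 ^ n) → ZMod 2) : Measure (Fin (2 ^ n) → Y) :=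
  Measure.pi fun k => W (polarTransform n u k)

/-- The min-sum synthetic joint distribution of index `i` at length `N = 2 ^ n`, as a measure in
the label for each value `b` of the bit: for `U` uniform on `{0, 1} ^ N` and `Y` the outputs when
the polar transform of `U` is sent, it maps a set `B` of labels to
`Pr (label (Y, U_0, ..., U_{i-1}) ∈ B, U_i = b)`. -/
def synthDist {Y : Type*} [MeasurableSpace Y] (W : ZMod 2 → Measure Y) (lab : Y → ℝ)
    (n : ℕ) (i : Fin (2 ^ n)) (b : ZMod 2) : Measure ℝ :=
  ∑ u : Fin (2 ^ n) → ZMod 2 with u i = b,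
    ((2 : ℝ≥0∞) ^ (2 ^ n))⁻¹ • (outputLaw W n u).map (fun y => minSumLabel lab n i y u)

/-- `Z(Q, ξ) = 2 * ∑ t, Q(t; 0) * ξ ^ t`, possibly infinite; `Q` is `Q(·; 0)`. -/
def Zxi (Q : Measure ℝ) (ξ : ℝ) : ℝ≥0∞ := 2 * ∫⁻ t, ENNReal.ofReal (ξ ^ t) ∂Q

/-- The optimized Bhattacharyya-like parameter: the infimum of `Z(Q, ξ)` over `0 < ξ ≤ 1`.
For the measures `Q(·; 0)` of synthetic distributions, `Z(Q, 1) = 1`, so it is finite. -/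
def Zstar (Q : Measure ℝ) : ℝ := (⨅ ξ ∈ Set.Ioc (0 : ℝ) 1, Zxi Q ξ).toReal

/-! ### Full binary trees and valid pairs -/

/-- A depth-index pair `(d, j)` with `0 ≤ j < 2 ^ d`. -/
abbrev Vertex : Type := Σ d : ℕ, Fin (2 ^ d)

/-- The root `(0, 0)`. -/
def Vertex.root : Vertex := ⟨0, 0⟩

/-- The left child `(d + 1, 2 * j)`. -/
def Vertex.left (v : Vertex) : Vertex :=
  ⟨v.1 + 1, ⟨2 * v.2, by have := v.2.2; rw [pow_succ]; omega⟩⟩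

/-- The right child `(d + 1, 2 * j + 1)`. -/
def Vertex.right (v : Vertex) : Vertex :=
  ⟨v.1 + 1, ⟨2 * v.2 + 1, by have := v.2.2; rw [pow_succ]; omega⟩⟩

/-- `g` lies on the path from the root to `v` (endpoints included). -/
def Vertex.OnPath (g v : Vertex) : Prop :=
  g.1 ≤ v.1 ∧ (v.2 : ℕ) / 2 ^ (v.1 - g.1) = g.2

/-- `T` is the vertex set of a (finite) full binary tree with root `(0, 0)`: every vertex has
either both children or none. -/
structure IsFullBinaryTree (T : Finset Vertex) : Prop where
  root_mem : Vertex.root ∈ T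
  mem_of_left : ∀ v : Vertex, v.left ∈ T → v ∈ T
  left_iff_right : ∀ v : Vertex, v.left ∈ T ↔ v.right ∈ T

/-- `(G, E)` is a valid pair: for some full binary tree, `E` is the set of its leaves and `G` is a
set of its vertices such that every path from the root to a leaf contains exactly one vertex
of `G`. -/
def IsValidPair (G E : Finset Vertex) : Prop :=
  ∃ T : Finset Vertex, IsFullBinaryTree T ∧
    (∀ v : Vertex, v ∈ E ↔ v ∈ T ∧ v.left ∉ T ∧ v.right ∉ T) ∧
    G ⊆ T ∧ ∀ v ∈ E, ∃! g : Vertex, g ∈ G ∧ g.OnPath v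

/-! ### The lower threshold -/

/-- The golden ratio based function `δ'(η) = 2 * (8 * η) ^ (log₂ φ)`, `φ = (1 + √5) / 2`. -/
def deltaPrime (η : ℝ) : ℝ := 2 * (8 * η) ^ Real.logb 2 ((1 + Real.sqrt 5) / 2)

/-- The quantities `ζ` at depth `d` and index `j`: the exact value of `Zstar` at the vertices of
`G`, and below them doubled at each left (even) step and squared at each right (odd) step.  If the root is
not in `G`, its value is a placeholder: for a valid pair, every vertex of `E` is in or below `G`,
so values strictly above `G` are not used. -/
def zeta {Y : Type*} [MeasurableSpace Y] (W : ZMod 2 → Measure Y) (lab : Y → ℝ)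
    (G : Finset Vertex) : (d : ℕ) → Fin (2 ^ d) → ℝ
  | 0, j => Zstar (synthDist W lab 0 j 0)
  | d + 1, j =>
      if (⟨d + 1, j⟩ : Vertex) ∈ G then Zstar (synthDist W lab (d + 1) j 0)
      else if (j : ℕ) % 2 = 0 then 2 * zeta W lab G d (halfIndex j)
      else zeta W lab G d (halfIndex j) ^ 2

/-- `R_L(G, E)`. -/
def RL {Y : Type*} [MeasurableSpace Y] (W : ZMod 2 → Measure Y) (lab : Y → ℝ)
    (G E : Finset Vertex) : ℝ :=
  ∑ v ∈ E, (1 / 2 ^ v.1) * max (1 - deltaPrime (zeta W lab G v.1 v.2)) 0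

/-! ### Polar codes under min-sum successive-cancellation decoding -/

/-- The decisions of the min-sum successive-cancellation decoder on the bits of index less than
`k`, for the non-frozen set `A` (the other entries are `0`).  At stage `k` the decoder decides `0`
if `k` is frozen or if the label, computed from the previous decisions, is nonnegative, and `1`
otherwise. -/
def scDecodeAux {Y : Type*} (lab : Y → ℝ) (n : ℕ) (A : Finset (Fin (2 ^ n)))
    (y : Fin (2 ^ n) → Y) : ℕ → Fin (2 ^ n) → ZMod 2
  | 0 => 0
  | k + 1 =>
      if h : k < 2 ^ n then
        Function.update (scDecodeAux lab n A y k) ⟨k, h⟩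
          (if (⟨k, h⟩ : Fin (2 ^ n)) ∈ A ∧
              minSumLabel lab n ⟨k, h⟩ y (scDecodeAux lab n A y k) < 0 then 1 else 0)
      else scDecodeAux lab n A y k

/-- The output of the min-sum successive-cancellation decoder. -/
def scDecode {Y : Type*} (lab : Y → ℝ) (n : ℕ) (A : Finset (Fin (2 ^ n)))
    (y : Fin (2 ^ n) → Y) : Fin (2 ^ n) → ZMod 2 :=
  scDecodeAux lab n A y (2 ^ n)

/-- The word error probability, under min-sum successive-cancellation decoding, of the polar code
of length `2 ^ n` with non-frozen index set `A`: the frozen bits are `0` and the other bits are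
uniform. -/
def wordErrorProb {Y : Type*} [MeasurableSpace Y] (W : ZMod 2 → Measure Y) (lab : Y → ℝ)
    (n : ℕ) (A : Finset (Fin (2 ^ n))) : ℝ :=
  (1 / 2 ^ A.card) * ∑ u : Fin (2 ^ n) → ZMod 2 with ∀ i, i ∉ A → u i = 0,
    (outputLaw W n u).real {y | scDecode lab n A y ≠ u}

/-- The rate of the polar code of length `2 ^ n` with non-frozen index set `A`. -/
def codeRate (n : ℕ) (A : Finset (Fin (2 ^ n))) : ℝ := A.card / 2 ^ n

/-- `U` is a valid upper threshold: for code rates exceeding `U`, the word error probability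
approaches `1` as the length grows, irrespective of which bits are frozen. -/
def IsUpperThreshold {Y : Type*} [MeasurableSpace Y] (W : ZMod 2 → Measure Y) (lab : Y → ℝ)
    (U : ℝ) : Prop :=
  ∀ R : ℝ, U < R → ∀ ε : ℝ, 0 < ε → ∃ n₀ : ℕ, ∀ n : ℕ, n₀ ≤ n →
    ∀ A : Finset (Fin (2 ^ n)), R ≤ codeRate n A → 1 - ε ≤ wordErrorProb W lab n A

end

end MinSumPolar

open MinSumPolar

namespace MinSumPolar

/-! ### The random walk `x ↦ x - 1` or `x ↦ 2 * x` -/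

section Walk

open Filter Topology Real

/-- One step of the transition operator of the walk that moves from `x` to `x - 1` or to `2 * x`,
each with probability `1 / 2`. -/
noncomputable def walkAvg (h : ℝ → ℝ) (x : ℝ) : ℝ := (h (x - 1) + h (2 * x)) / 2

/-- The probability that the walk started at `x` is below `τ` at time `m`. -/
noncomputable def walkProb (τ : ℝ) : ℕ → ℝ → ℝ
  | 0 => fun x => if x < τ then 1 else 0
  | m + 1 => walkAvg (walkProb τ m)

theorem walkProb_le_one (τ : ℝ) (m : ℕ) (x : ℝ) : walkProb τ m x ≤ 1 := by
  induction m generalizing x with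
  | zero => simp only [walkProb]; split_ifs <;> norm_num
  | succ m ih =>
    simp only [walkProb, walkAvg]
    linarith [ih (x - 1), ih (2 * x)]

/-- Comparison with a family that is superharmonic above `K` and at least `1` below `K`. -/
theorem walkProb_le_of_superharmonic {τ K : ℝ} {h : ℕ → ℝ → ℝ} (h0 : ∀ x, 0 ≤ h 0 x)
    (h1 : ∀ x, K ≤ x → x < τ → 1 ≤ h 0 x) (hlow : ∀ m x, x < K → 1 ≤ h m x)
    (hstep : ∀ m x, K ≤ x → walkAvg (h m) x ≤ h (m + 1) x) (m : ℕ) (x : ℝ) :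
    walkProb τ m x ≤ h m x := by
  induction m generalizing x with
  | zero =>
    simp only [walkProb]
    split_ifs with hx
    · rcases lt_or_ge x K with hK | hK
      · exact hlow 0 x hK
      · exact h1 x hK hx
    · exact h0 x
  | succ m ih =>
    rcases lt_or_ge x K with hK | hK
    · exact (walkProb_le_one _ _ _).trans (hlow _ _ hK)
    · refine le_trans ?_ (hstep m x hK)
      simp only [walkProb, walkAvg]
      linarith [ih (x - 1), ih (2 * x)]

/-- The Markov property: a bound after `k` steps is propagated by `m` further steps. -/
theorem walkProb_add_le {τ τ' c : ℝ} {k : ℕ}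
    (h : ∀ x, walkProb τ k x ≤ c + walkProb τ' 0 x) (m : ℕ) (x : ℝ) :
    walkProb τ (k + m) x ≤ c + walkProb τ' m x := by
  induction m generalizing x with
  | zero => exact h x
  | succ m ih =>
    rw [← add_assoc]
    simp only [walkProb, walkAvg]
    linarith [ih (x - 1), ih (2 * x)]

/-- After dividing by φ^(K-x) the claim is φ + φ^(-x) ≤ 2, with equality exactly at x = 2 because
φ^(-2) = 2 - φ. This is where the golden ratio and the level 2 come from. -/
theorem walkAvg_goldenRatio_le {K x : ℝ} (hK : 2 ≤ K) (hx : K ≤ x) :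
    walkAvg (fun y => goldenRatio ^ (K - y)) x ≤ goldenRatio ^ (K - x) := by
  have hφ := goldenRatio_pos
  have e1 : goldenRatio ^ (K - (x - 1)) = goldenRatio ^ (K - x) * goldenRatio := by
    rw [show K - (x - 1) = (K - x) + 1 by ring, rpow_add hφ, rpow_one]
  have e2 : goldenRatio ^ (K - 2 * x) = goldenRatio ^ (K - x) * goldenRatio ^ (-x) := by
    rw [show K - 2 * x = (K - x) + (-x) by ring, rpow_add hφ]
  have e3 : goldenRatio ^ (-x) ≤ 2 - goldenRatio := by
    have h1 : goldenRatio ^ (-x) ≤ goldenRatio ^ (-2 : ℝ) :=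
      rpow_le_rpow_of_exponent_le one_lt_goldenRatio.le (by linarith)
    have h2 : goldenRatio ^ (-2 : ℝ) = 2 - goldenRatio := by
      rw [rpow_neg hφ.le, rpow_ofNat, inv_eq_one_div, div_eq_iff (by positivity)]
      have := goldenRatio_sq
      nlinarith
    linarith
  simp only [walkAvg, e1, e2]
  have h0 : 0 < goldenRatio ^ (K - x) := rpow_pos_of_pos hφ _
  nlinarith

/-- A base strictly between 1 and φ turns superharmonicity into strict contraction: (3/2 +
(3/2)^(-2))/2 = 35/36. This forces the surviving walk to leave every bounded range. -/
theorem walkAvg_three_halves_le (τ : ℝ) {x : ℝ} (hx : 2 ≤ x) :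
    walkAvg (fun y => (3 / 2 : ℝ) ^ (τ - y)) x ≤ 35 / 36 * (3 / 2 : ℝ) ^ (τ - x) := by
  have hb : (0 : ℝ) < 3 / 2 := by norm_num
  have e1 : (3 / 2 : ℝ) ^ (τ - (x - 1)) = (3 / 2 : ℝ) ^ (τ - x) * (3 / 2) := by
    rw [show τ - (x - 1) = (τ - x) + 1 by ring, rpow_add hb, rpow_one]
  have e2 : (3 / 2 : ℝ) ^ (τ - 2 * x) = (3 / 2 : ℝ) ^ (τ - x) * (3 / 2 : ℝ) ^ (-x) := by
    rw [show τ - 2 * x = (τ - x) + (-x) by ring, rpow_add hb]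
  have e3 : (3 / 2 : ℝ) ^ (-x) ≤ 4 / 9 := by
    have h1 : (3 / 2 : ℝ) ^ (-x) ≤ (3 / 2 : ℝ) ^ (-2 : ℝ) :=
      rpow_le_rpow_of_exponent_le (by norm_num) (by linarith)
    have h2 : (3 / 2 : ℝ) ^ (-2 : ℝ) = 4 / 9 := by
      rw [rpow_neg hb.le, rpow_ofNat]; norm_num
    linarith
  simp only [walkAvg, e1, e2]
  have h0 : 0 < (3 / 2 : ℝ) ^ (τ - x) := rpow_pos_of_pos hb _
  nlinarith

/-- Escape estimate: up to a vanishing term, the walk is below a fixed level only if it fell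
below `2`. -/
theorem walkProb_le_escape (τ : ℝ) (m : ℕ) (x : ℝ) :
    walkProb τ m x ≤ goldenRatio ^ (2 - x) + (35 / 36) ^ m * (3 / 2 : ℝ) ^ (τ - x) := by
  have hφ := goldenRatio_pos
  refine walkProb_le_of_superharmonic (K := 2)
    (h := fun m x => goldenRatio ^ (2 - x) + (35 / 36) ^ m * (3 / 2 : ℝ) ^ (τ - x))
    (fun x => by positivity) ?_ ?_ ?_ m x
  · intro x _ hx
    have h1 : 1 ≤ (3 / 2 : ℝ) ^ (τ - x) := one_le_rpow (by norm_num) (by linarith)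
    have h2 : 0 < goldenRatio ^ (2 - x) := rpow_pos_of_pos hφ _
    simp only [pow_zero, one_mul]
    linarith
  · intro m x hx
    have h1 : 1 ≤ goldenRatio ^ (2 - x) := one_le_rpow one_lt_goldenRatio.le (by linarith)
    have h2 : 0 < (35 / 36 : ℝ) ^ m * (3 / 2 : ℝ) ^ (τ - x) := by positivity
    linarith
  · intro m x hx
    have h1 := walkAvg_goldenRatio_le le_rfl hx
    have h2 := mul_le_mul_of_nonneg_left (walkAvg_three_halves_le τ hx)
      (show (0 : ℝ) ≤ (35 / 36) ^ m by positivity)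
    simp only [walkAvg] at h1 h2 ⊢
    rw [pow_succ]
    linarith

/-- Growth estimate above a level `K` at which negative powers are contracted by `ρ`. -/
theorem walkProb_le_growth {τ K s ρ : ℝ} (hτ : 0 < τ) (hK : 2 ≤ K) (hs : 0 < s) (hρ : 0 ≤ ρ)
    (hc : ∀ x, K ≤ x → ((x - 1) ^ (-s) + (2 * x) ^ (-s)) / 2 ≤ ρ * x ^ (-s)) (m : ℕ) (x : ℝ) :
    walkProb τ m x ≤ goldenRatio ^ (K - x) + ρ ^ m * (τ ^ s * (max x 1) ^ (-s)) := by
  have hφ := goldenRatio_pos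
  refine walkProb_le_of_superharmonic (K := K)
    (h := fun m x => goldenRatio ^ (K - x) + ρ ^ m * (τ ^ s * (max x 1) ^ (-s)))
    (fun x => by positivity) ?_ ?_ ?_ m x
  · intro x hx hxτ
    have hx0 : 0 < x := by linarith
    -- Markov's inequality for the negative power: x < τ means (τ/x)^s ≥ 1.
    have h1 : 1 ≤ τ ^ s * x ^ (-s) := by
      rw [rpow_neg hx0.le, ← div_eq_mul_inv, ← div_rpow hτ.le hx0.le]
      exact one_le_rpow ((one_le_div hx0).2 hxτ.le) hs.le
    have h2 : 0 < goldenRatio ^ (K - x) := rpow_pos_of_pos hφ _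
    simp only [pow_zero, one_mul]
    rw [max_eq_left (by linarith)]
    linarith
  · intro m x hx
    have h1 : 1 ≤ goldenRatio ^ (K - x) := one_le_rpow one_lt_goldenRatio.le (by linarith)
    have h2 : 0 ≤ ρ ^ m * (τ ^ s * (max x 1) ^ (-s)) := by positivity
    linarith
  · intro m x hx
    have h1 := walkAvg_goldenRatio_le hK hx
    have h2 := mul_le_mul_of_nonneg_left (hc x hx)
      (show (0 : ℝ) ≤ ρ ^ m * τ ^ s by positivity)
    simp only [walkAvg] at h1 ⊢
    -- The truncation at 1 only keeps the power harmless at low or negative positions; it is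
    -- inactive here, since x ≥ K ≥ 2 gives x - 1 ≥ 1.
    rw [pow_succ, max_eq_left (by linarith : (1 : ℝ) ≤ x),
      max_eq_left (by linarith : (1 : ℝ) ≤ x - 1), max_eq_left (by linarith : (1 : ℝ) ≤ 2 * x)]
    nlinarith

/-- Equivalently 2^(βs) + 2^((β-1)s) < 2. Equality holds at s = 0, and the derivative there is (2β -
1) log 2 < 0, so a small positive s works. This is the only place where β < 1/2 is needed for the
growth of the walk. -/
theorem exists_exponent {β : ℝ} (hβ : β < 1 / 2) :
    ∃ s : ℝ, 0 < s ∧ (1 + (2 : ℝ) ^ (-s)) / 2 < (2 : ℝ) ^ (-(β * s)) := by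
  have hd : HasDerivAt (fun s : ℝ => (2 : ℝ) ^ (β * s) + (2 : ℝ) ^ ((β - 1) * s))
      (log 2 * (2 * β - 1)) 0 := by
    have h1 : HasDerivAt (fun s : ℝ => (2 : ℝ) ^ (β * s)) _ 0 :=
      ((hasDerivAt_id (0 : ℝ)).const_mul β).const_rpow (by norm_num : (0 : ℝ) < 2)
    have h2 : HasDerivAt (fun s : ℝ => (2 : ℝ) ^ ((β - 1) * s)) _ 0 :=
      ((hasDerivAt_id (0 : ℝ)).const_mul (β - 1)).const_rpow (by norm_num : (0 : ℝ) < 2)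
    refine (h1.add h2).congr_deriv ?_
    simp
    ring
  have hneg : log 2 * (2 * β - 1) < 0 :=
    mul_neg_of_pos_of_neg (log_pos (by norm_num)) (by linarith)
  have hsl := hd.tendsto_slope.eventually (gt_mem_nhds hneg)
  have hsl' : ∀ᶠ s in 𝓝[>] (0 : ℝ), slope (fun s : ℝ => (2 : ℝ) ^ (β * s) + (2 : ℝ) ^ ((β - 1) * s)) 0 s < 0 :=
    hsl.filter_mono (nhdsWithin_mono _ (fun x hx => (ne_of_gt hx)))
  obtain ⟨s, hs, hs0⟩ := (hsl'.and self_mem_nhdsWithin).exists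
  have hs0 : 0 < s := hs0
  refine ⟨s, hs0, ?_⟩
  rw [slope_def_field, div_neg_iff] at hs
  rcases hs with hs | hs
  · linarith [hs.2]
  · have h3 := hs.1
    simp only [mul_zero, rpow_zero] at h3
    have e1 : (2 : ℝ) ^ ((β - 1) * s) = (2 : ℝ) ^ (β * s) * (2 : ℝ) ^ (-s) := by
      rw [← rpow_add (by norm_num)]; ring_nf
    have hp : (0 : ℝ) < (2 : ℝ) ^ (β * s) := by positivity
    rw [rpow_neg (by norm_num) (β * s), lt_inv_comm₀ (by positivity) hp, lt_inv_comm₀ hp (by positivity),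
      inv_eq_one_div, lt_div_iff₀ hp]
    rw [e1] at h3
    linarith

/-- Relative to x^(-s) the average tends to (1 + 2^(-s))/2 as x → ∞, since the decrement by 1
becomes negligible; any larger ρ therefore works from some level on. -/
theorem exists_contraction_level {s ρ : ℝ} (hs : (1 + (2 : ℝ) ^ (-s)) / 2 < ρ) :
    ∃ K : ℝ, 2 ≤ K ∧ ∀ x, K ≤ x → ((x - 1) ^ (-s) + (2 * x) ^ (-s)) / 2 ≤ ρ * x ^ (-s) := by
  have ht : Tendsto (fun x : ℝ => ((1 - x⁻¹) ^ (-s) + (2 : ℝ) ^ (-s)) / 2) atTop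
      (𝓝 (((1 - 0) ^ (-s) + (2 : ℝ) ^ (-s)) / 2)) := by
    refine ((Tendsto.rpow_const ?_ (Or.inl (by norm_num))).add tendsto_const_nhds).div_const 2
    exact tendsto_const_nhds.sub tendsto_inv_atTop_zero
  have hev := ht.eventually (gt_mem_nhds (show ((1 - 0) ^ (-s) + (2 : ℝ) ^ (-s)) / 2 < ρ by simpa using hs))
  obtain ⟨K, hK⟩ := eventually_atTop.1 hev
  refine ⟨max K 2, le_max_right _ _, fun x hx => ?_⟩
  have hx2 : 2 ≤ x := (le_max_right _ _).trans hx
  have h := hK x ((le_max_left _ _).trans hx)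
  have hx0 : 0 < x := by linarith
  have hinv : 0 ≤ 1 - x⁻¹ := by
    have := inv_le_one_of_one_le₀ (by linarith : (1 : ℝ) ≤ x)
    linarith
  have e1 : x - 1 = (1 - x⁻¹) * x := by field_simp
  rw [e1, mul_rpow hinv hx0.le, mul_rpow (by norm_num) hx0.le]
  have h0 : 0 < x ^ (-s) := by positivity
  nlinarith

/-- The walk started at `x` exceeds `2 ^ (β * m)` at large times `m`, for every `β < 1 / 2`, with
probability at least `1 - φ ^ (2 - x)`. -/
theorem eventually_walkProb_le {β : ℝ} (hβ : β < 1 / 2) (x : ℝ) {ε : ℝ} (hε : 0 < ε) :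
    ∀ᶠ m : ℕ in atTop, walkProb ((2 : ℝ) ^ (β * m)) m x ≤ goldenRatio ^ (2 - x) + ε := by
  obtain ⟨s, hs, hsβ⟩ := exists_exponent hβ
  obtain ⟨ρ, hρ1, hρ2⟩ := exists_between hsβ
  have hρ0 : 0 < ρ := lt_trans (by positivity) hρ1
  obtain ⟨K, hK, hc⟩ := exists_contraction_level hρ1
  have hφ := goldenRatio_pos
  -- L is the safety margin: from level K + L the walk ever falls below K with probability at most
  -- ε/3.
  obtain ⟨L, hL⟩ : ∃ L : ℝ, goldenRatio ^ (-L) ≤ ε / 3 := by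
    obtain ⟨n, hn⟩ := exists_pow_lt_of_lt_one (show 0 < ε / 3 by positivity)
      (inv_lt_one_of_one_lt₀ one_lt_goldenRatio)
    refine ⟨n, ?_⟩
    rw [rpow_neg hφ.le, rpow_natCast, ← inv_pow]
    exact hn.le
  -- A fixed number m₁ of initial steps carries the walk above K + L, up to φ^(2-x) + ε/3.
  obtain ⟨m₁, hm₁⟩ : ∃ m₁ : ℕ, (35 / 36 : ℝ) ^ m₁ * (3 / 2 : ℝ) ^ (K + L - x) ≤ ε / 3 := by
    have hp : (0 : ℝ) < (3 / 2 : ℝ) ^ (K + L - x) := by positivity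
    obtain ⟨n, hn⟩ := exists_pow_lt_of_lt_one
      (show 0 < ε / 3 / (3 / 2 : ℝ) ^ (K + L - x) by positivity) (by norm_num : (35 / 36 : ℝ) < 1)
    exact ⟨n, ((lt_div_iff₀ hp).1 hn).le⟩
  have hq : (2 : ℝ) ^ (β * s) * ρ < 1 := by
    rw [rpow_neg (by norm_num)] at hρ2
    have hp : (0 : ℝ) < (2 : ℝ) ^ (β * s) := by positivity
    calc (2 : ℝ) ^ (β * s) * ρ < (2 : ℝ) ^ (β * s) * ((2 : ℝ) ^ (β * s))⁻¹ := by gcongr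
      _ = 1 := mul_inv_cancel₀ hp.ne'
  -- The target 2^(β(k+m₁)) also counts the initial phase, which costs only the constant factor
  -- (2^(βs))^m₁ against geometric decay in k.
  have hlim : Tendsto (fun k : ℕ => ((2 : ℝ) ^ (β * s)) ^ m₁ * ((2 : ℝ) ^ (β * s) * ρ) ^ k)
      atTop (𝓝 (((2 : ℝ) ^ (β * s)) ^ m₁ * 0)) :=
    (tendsto_pow_atTop_nhds_zero_of_lt_one (by positivity) hq).const_mul _
  rw [mul_zero] at hlim
  have hev := (hlim.eventually (gt_mem_nhds (show 0 < ε / 3 by positivity)))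
  rw [← map_add_atTop_eq_nat m₁, eventually_map]
  filter_upwards [hev] with k hk
  have hτ : (0 : ℝ) < (2 : ℝ) ^ (β * ((k + m₁ : ℕ) : ℝ)) := by positivity
  have hτs : ((2 : ℝ) ^ (β * ((k + m₁ : ℕ) : ℝ))) ^ s =
      ((2 : ℝ) ^ (β * s)) ^ m₁ * ((2 : ℝ) ^ (β * s)) ^ k := by
    rw [← pow_add, ← rpow_natCast, ← rpow_mul (by norm_num), ← rpow_mul (by norm_num)]
    congr 1
    push_cast
    ring
  -- Second phase, k steps: below K + L the trivial bound 1 is charged to the first phase; above it,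
  -- both error terms of the growth estimate are at most ε/3.
  have hphase : ∀ y, walkProb ((2 : ℝ) ^ (β * ((k + m₁ : ℕ) : ℝ))) k y ≤
      (ε / 3 + ε / 3) + walkProb (K + L) 0 y := by
    intro y
    simp only [walkProb]
    split_ifs with hy
    · linarith [walkProb_le_one ((2 : ℝ) ^ (β * ((k + m₁ : ℕ) : ℝ))) k y]
    · have h := walkProb_le_growth hτ hK hs hρ0.le hc k y
      have h1 : goldenRatio ^ (K - y) ≤ goldenRatio ^ (-L) :=
        rpow_le_rpow_of_exponent_le one_lt_goldenRatio.le (by linarith)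
      have h2 : (max y 1) ^ (-s) ≤ 1 :=
        rpow_le_one_of_one_le_of_nonpos (le_max_right _ _) (by linarith)
      have h3 : ρ ^ k * (((2 : ℝ) ^ (β * ((k + m₁ : ℕ) : ℝ))) ^ s * (max y 1) ^ (-s)) ≤
          ((2 : ℝ) ^ (β * s)) ^ m₁ * ((2 : ℝ) ^ (β * s) * ρ) ^ k := by
        calc _ ≤ ρ ^ k * (((2 : ℝ) ^ (β * ((k + m₁ : ℕ) : ℝ))) ^ s * 1) := by gcongr
          _ = _ := by rw [hτs, mul_pow]; ring
      linarith
  have h1 := walkProb_add_le hphase m₁ x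
  have h2 := walkProb_le_escape (K + L) m₁ x
  linarith

end Walk

/-! ### Counting descendants in the index tree -/

section Counting

open Filter Topology Real Finset

/-- The descendants at depth `d + m` of the vertex `(d, j)`. -/
def descendants (m j : ℕ) : Finset ℕ := Finset.Ico (j * 2 ^ m) ((j + 1) * 2 ^ m)

theorem card_descendants (m j : ℕ) : (descendants m j).card = 2 ^ m := by
  simp [descendants, add_mul]

theorem mem_descendants {m j i : ℕ} : i ∈ descendants m j ↔ i / 2 ^ m = j := by
  rw [descendants, Finset.mem_Ico, Nat.div_eq_iff (by positivity)]
  have : 0 < 2 ^ m := by positivity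
  rw [add_mul]
  omega

theorem descendants_succ (m j : ℕ) :
    descendants (m + 1) j = descendants m (2 * j) ∪ descendants m (2 * j + 1) := by
  ext i
  simp only [Finset.mem_union, mem_descendants, pow_succ, ← Nat.div_div_eq_div_mul]
  omega

/-- If the parameter `z` at most doubles at left steps and is at most squared at right steps, then
the share of descendants with a large parameter is bounded by the random walk. -/
theorem card_descendants_filter_le {z : ℕ → ℕ → ℝ} (hz0 : ∀ n i, 0 ≤ z n i)
    (hleft : ∀ n j, z (n + 1) (2 * j) ≤ 2 * z n j)
    (hright : ∀ n j, z (n + 1) (2 * j + 1) ≤ z n j ^ 2) (τ : ℝ) (m d j : ℕ) (x : ℝ)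
    (hx : z d j ≤ (2 : ℝ) ^ (-x)) :
    (((descendants m j).filter fun i => ¬ z (d + m) i ≤ (2 : ℝ) ^ (-τ)).card : ℝ) ≤
      2 ^ m * walkProb τ m x := by
  induction m generalizing d j x with
  | zero =>
    have h1 := Finset.card_filter_le (descendants 0 j) fun i => ¬ z (d + 0) i ≤ (2 : ℝ) ^ (-τ)
    rw [card_descendants] at h1
    simp only [walkProb, pow_zero, one_mul]
    split_ifs with hτ
    · exact_mod_cast h1
    · rw [Finset.filter_false_of_mem]
      · simp
      · intro i hi
        rw [mem_descendants, pow_zero, Nat.div_one] at hi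
        subst hi
        rw [not_not]
        exact hx.trans (rpow_le_rpow_of_exponent_le (by norm_num) (by linarith))
  | succ m ih =>
    have h2 : (0 : ℝ) < 2 := by norm_num
    have hl : z (d + 1) (2 * j) ≤ (2 : ℝ) ^ (-(x - 1)) := by
      refine (hleft d j).trans ?_
      rw [show -(x - 1) = 1 + -x by ring, rpow_add h2, rpow_one]
      linarith
    have hr : z (d + 1) (2 * j + 1) ≤ (2 : ℝ) ^ (-(2 * x)) := by
      refine (hright d j).trans ((pow_le_pow_left₀ (hz0 d j) hx 2).trans_eq ?_)
      rw [← rpow_natCast, ← rpow_mul h2.le]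
      congr 1
      push_cast
      ring
    have e : d + (m + 1) = d + 1 + m := by ring
    -- The first step below (d, j) is split off, matching the first step of the walk; each child has
    -- its own level bound.
    rw [e, descendants_succ, Finset.filter_union]
    have hc := Finset.card_union_le
      ((descendants m (2 * j)).filter fun i => ¬ z (d + 1 + m) i ≤ (2 : ℝ) ^ (-τ))
      ((descendants m (2 * j + 1)).filter fun i => ¬ z (d + 1 + m) i ≤ (2 : ℝ) ^ (-τ))
    have hc' : (((((descendants m (2 * j)).filter fun i => ¬ z (d + 1 + m) i ≤ (2 : ℝ) ^ (-τ)) ∪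
      ((descendants m (2 * j + 1)).filter fun i => ¬ z (d + 1 + m) i ≤ (2 : ℝ) ^ (-τ))).card : ℕ) : ℝ)
      ≤ _ := Nat.cast_le.2 hc
    push_cast at hc'
    have i1 := ih (d + 1) (2 * j) (x - 1) hl
    have i2 := ih (d + 1) (2 * j + 1) (2 * x) hr
    simp only [walkProb, walkAvg]
    rw [pow_succ]
    linarith

/-! ### From walk levels to `deltaPrime` and the decoding threshold. -/

theorem deltaPrime_eq {η : ℝ} (hη : 0 < η) :
    deltaPrime η = 2 * goldenRatio ^ (3 + logb 2 η) := by
  have hφ := goldenRatio_pos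
  have h8 : 8 * η = (2 : ℝ) ^ (3 + logb 2 η) := by
    rw [rpow_add (by norm_num), rpow_logb (by norm_num) (by norm_num) hη]
    norm_num
  rw [deltaPrime, h8, ← rpow_mul (by norm_num), mul_comm (3 + logb 2 η), rpow_mul (by norm_num),
    rpow_logb (by norm_num) (by norm_num) hφ]

/-- For η > 0 the level is x = -log₂ η, where δ'(η) = 2φ^(3-x) exceeds φ^(2-x). For η = 0 every
level is allowed, and ε absorbs φ^(2-x) at a large one. -/
theorem exists_level {η : ℝ} (hη : 0 ≤ η) {ε : ℝ} (hε : 0 < ε) :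
    ∃ x : ℝ, η ≤ (2 : ℝ) ^ (-x) ∧ goldenRatio ^ (2 - x) ≤ deltaPrime η + ε := by
  have hφ := goldenRatio_pos
  rcases hη.eq_or_lt with rfl | hη
  · obtain ⟨n, hn⟩ := exists_pow_lt_of_lt_one hε (inv_lt_one_of_one_lt₀ one_lt_goldenRatio)
    refine ⟨n + 2, by positivity, ?_⟩
    have h1 : 0 ≤ deltaPrime 0 := by unfold deltaPrime; positivity
    rw [show (2 : ℝ) - (n + 2) = -n by ring, rpow_neg hφ.le, rpow_natCast, ← inv_pow]
    linarith
  · refine ⟨-logb 2 η, ?_, ?_⟩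
    · rw [neg_neg, rpow_logb (by norm_num) (by norm_num) hη]
    · rw [deltaPrime_eq hη]
      have h1 : goldenRatio ^ (2 - -logb 2 η) ≤ goldenRatio ^ (3 + logb 2 η) :=
        rpow_le_rpow_of_exponent_le one_lt_goldenRatio.le (by linarith)
      have h2 : 0 < goldenRatio ^ (3 + logb 2 η) := rpow_pos_of_pos hφ _
      linarith

/-- The decoding threshold `2 ^ (-N ^ β) / N` at depth `d + m` is eventually above
`2 ^ (-2 ^ (β' * m))` if `β < β'`. -/
theorem eventually_threshold_le {β β' : ℝ} (hβ0 : 0 < β) (h : β < β') (d : ℕ) :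
    ∀ᶠ m : ℕ in atTop, (2 : ℝ) ^ (-(2 : ℝ) ^ (β' * m)) ≤
      (2 : ℝ) ^ (-((2 : ℝ) ^ (d + m)) ^ β) / 2 ^ (d + m) := by
  have hr : (1 : ℝ) < (2 : ℝ) ^ β := one_lt_rpow (by norm_num) hβ0
  have hq : (1 : ℝ) < (2 : ℝ) ^ (β' - β) := one_lt_rpow (by norm_num) (by linarith)
  -- Write 2^(β'm) as q^m r^m with q = 2^(β'-β) and r = 2^β. Of the factor q^m ≥ (2^d)^β + 1, the
  -- first summand pays for N^β and the second, by r^m ≥ d + m, for the division by N.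
  have h1 := (tendsto_pow_atTop_atTop_of_one_lt hq).eventually_ge_atTop
    (((2 : ℝ) ^ d) ^ β + 1)
  have h2 : ∀ᶠ m : ℕ in atTop, ((d + m : ℕ) : ℝ) ≤ ((2 : ℝ) ^ β) ^ m := by
    have ht : Tendsto (fun m : ℕ => (m : ℝ) ^ 1 / ((2 : ℝ) ^ β) ^ m) atTop (𝓝 0) :=
      tendsto_pow_const_div_const_pow_of_one_lt 1 hr
    have hev := ht.eventually (gt_mem_nhds (show (0 : ℝ) < 1 / 2 by norm_num))
    filter_upwards [hev, eventually_ge_atTop d] with m hm hmd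
    rw [pow_one, div_lt_iff₀ (by positivity)] at hm
    have : (d : ℝ) ≤ m := by exact_mod_cast hmd
    push_cast
    linarith
  filter_upwards [h1, h2] with m h1 h2
  have e : (2 : ℝ) ^ (-((2 : ℝ) ^ (d + m)) ^ β) / 2 ^ (d + m) =
      (2 : ℝ) ^ (-((2 : ℝ) ^ (d + m)) ^ β - ((d + m : ℕ) : ℝ)) := by
    rw [rpow_sub (by norm_num), rpow_natCast]
  rw [e]
  refine rpow_le_rpow_of_exponent_le (by norm_num) ?_
  have e1 : ((2 : ℝ) ^ (d + m)) ^ β = ((2 : ℝ) ^ d) ^ β * ((2 : ℝ) ^ β) ^ m := by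
    rw [pow_add, mul_rpow (by positivity) (by positivity), ← rpow_natCast 2 m, ← rpow_mul (by norm_num),
      ← rpow_natCast _ m, ← rpow_mul (by norm_num), mul_comm (m : ℝ)]
  have e2 : (2 : ℝ) ^ (β' * m) = ((2 : ℝ) ^ (β' - β)) ^ m * ((2 : ℝ) ^ β) ^ m := by
    rw [← mul_pow, ← rpow_add (by norm_num), ← rpow_natCast _ m, ← rpow_mul (by norm_num)]
    ring_nf
  rw [e1, e2]
  have h3 : 0 < ((2 : ℝ) ^ β) ^ m := by positivity
  nlinarith

/-- A vertex with parameter at most `η` has asymptotically a share at least `1 - δ' η` of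
descendants with parameter below the decoding threshold. -/
theorem eventually_card_good_descendants {z : ℕ → ℕ → ℝ} (hz0 : ∀ n i, 0 ≤ z n i)
    (hleft : ∀ n j, z (n + 1) (2 * j) ≤ 2 * z n j)
    (hright : ∀ n j, z (n + 1) (2 * j + 1) ≤ z n j ^ 2) {β : ℝ} (hβ0 : 0 < β) (hβ : β < 1 / 2)
    {d j : ℕ} {η : ℝ} (hη : z d j ≤ η) {ε : ℝ} (hε : 0 < ε) :
    ∀ᶠ n : ℕ in atTop, d ≤ n ∧ (1 / 2 ^ d) * (max (1 - deltaPrime η) 0 - ε) ≤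
      (((descendants (n - d) j).filter fun i =>
        z n i ≤ (2 : ℝ) ^ (-((2 : ℝ) ^ n) ^ β) / 2 ^ n).card : ℝ) / 2 ^ n := by
  obtain ⟨β', hβ1, hβ2⟩ := exists_between hβ
  obtain ⟨x, hx, hxδ⟩ := exists_level ((hz0 d j).trans hη) (half_pos hε)
  rw [← map_add_atTop_eq_nat d, eventually_map]
  filter_upwards [eventually_walkProb_le hβ2 x (half_pos hε),
    eventually_threshold_le hβ0 hβ1 d] with m hw ht
  refine ⟨Nat.le_add_left _ _, ?_⟩
  rw [Nat.add_sub_cancel, add_comm m d]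
  have hbad := card_descendants_filter_le hz0 hleft hright ((2 : ℝ) ^ (β' * m)) m d j x
    (hη.trans hx)
  have hsum := Finset.card_filter_add_card_filter_not (s := descendants m j)
    (fun i => z (d + m) i ≤ (2 : ℝ) ^ (-(2 : ℝ) ^ (β' * m)))
  rw [card_descendants] at hsum
  have hmono : ((descendants m j).filter fun i =>
      z (d + m) i ≤ (2 : ℝ) ^ (-(2 : ℝ) ^ (β' * m))).card ≤ ((descendants m j).filter fun i =>
        z (d + m) i ≤ (2 : ℝ) ^ (-((2 : ℝ) ^ (d + m)) ^ β) / 2 ^ (d + m)).card := by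
    refine Finset.card_le_card fun i hi => ?_
    rw [Finset.mem_filter] at hi ⊢
    exact ⟨hi.1, hi.2.trans ht⟩
  set good := ((descendants m j).filter fun i =>
    z (d + m) i ≤ (2 : ℝ) ^ (-((2 : ℝ) ^ (d + m)) ^ β) / 2 ^ (d + m)).card
  have hsum' : (((descendants m j).filter fun i =>
      z (d + m) i ≤ (2 : ℝ) ^ (-(2 : ℝ) ^ (β' * m))).card : ℝ) +
      ((descendants m j).filter fun i =>
        ¬ z (d + m) i ≤ (2 : ℝ) ^ (-(2 : ℝ) ^ (β' * m))).card = 2 ^ m := by exact_mod_cast hsum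
  have hmono' : (((descendants m j).filter fun i =>
      z (d + m) i ≤ (2 : ℝ) ^ (-(2 : ℝ) ^ (β' * m))).card : ℝ) ≤ good := by exact_mod_cast hmono
  have hgood0 : (0 : ℝ) ≤ good := Nat.cast_nonneg _
  have hm0 : (0 : ℝ) < 2 ^ m := by positivity
  have key : 2 ^ m * (max (1 - deltaPrime η) 0 - ε) ≤ (good : ℝ) := by
    rcases le_total (1 - deltaPrime η) 0 with hneg | hpos
    · rw [max_eq_right hneg]
      nlinarith
    · rw [max_eq_left hpos]
      have h3 : 2 ^ m * walkProb ((2 : ℝ) ^ (β' * m)) m x ≤ 2 ^ m * (deltaPrime η + ε) := by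
        gcongr
        linarith
      linarith
  rw [le_div_iff₀ (by positivity), pow_add]
  calc _ = 2 ^ m * (max (1 - deltaPrime η) 0 - ε) := by field_simp
    _ ≤ _ := key

/-- The vertex set of the tree contains the parent of each of its vertices. -/
theorem IsFullBinaryTree.parent_mem {T : Finset Vertex} (hT : IsFullBinaryTree T) {d : ℕ}
    {i : Fin (2 ^ (d + 1))} (h : (⟨d + 1, i⟩ : Vertex) ∈ T) :
    (⟨d, halfIndex i⟩ : Vertex) ∈ T ∧ Vertex.left ⟨d, halfIndex i⟩ ∈ T := by
  have key : Vertex.left ⟨d, halfIndex i⟩ ∈ T := by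
    rcases Nat.mod_two_eq_zero_or_one (i : ℕ) with hi | hi
    · convert h using 1
      simp only [Vertex.left, halfIndex]
      congr 2
      omega
    · rw [hT.left_iff_right]
      convert h using 1
      simp only [Vertex.right, halfIndex]
      congr 2
      omega
  exact ⟨hT.mem_of_left _ key, key⟩

/-- An index at depth `n` descends from at most one leaf of a full binary tree. -/
theorem IsFullBinaryTree.eq_of_leaf_of_le {T : Finset Vertex} (hT : IsFullBinaryTree T)
    {v w : Vertex} (hv : v.left ∉ T) (hw : w ∈ T) (hle : v.1 ≤ w.1)
    (h : (w.2 : ℕ) / 2 ^ (w.1 - v.1) = v.2) : v = w := by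
  obtain ⟨d, j⟩ := v
  obtain ⟨e, k⟩ := w
  obtain ⟨m, rfl⟩ := Nat.exists_eq_add_of_le hle
  simp only [Nat.add_sub_cancel_left] at h
  clear hle
  induction m with
  | zero =>
    rw [pow_zero, Nat.div_one] at h
    congr 1
    exact Fin.ext h.symm
  | succ m ih =>
    exfalso
    obtain ⟨h1, h2⟩ := hT.parent_mem (d := d + m) (i := k) hw
    have h' : ((halfIndex (n := d + m) k : Fin (2 ^ (d + m))) : ℕ) / 2 ^ m = j := by
      rw [← h]
      simp only [halfIndex]
      rw [Nat.div_div_eq_div_mul, ← pow_succ']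
    -- The parent of w would have to be v, yet this parent has a left child in T.
    have := ih (halfIndex (n := d + m) k) h1 h'
    rw [← this] at h2
    exact hv h2

end Counting

/-! ### Channel symmetry -/

section Symmetry

/-- The real sign `(-1) ^ u` of a bit. -/
noncomputable def bitSign (u : ZMod 2) : ℝ := (-1) ^ u.val

theorem bitSign_zero : bitSign 0 = 1 := by simp [bitSign]

theorem bitSign_one : bitSign 1 = -1 := by simp [bitSign, ZMod.val_one]

theorem bit_eq_zero_or_one (u : ZMod 2) : u = 0 ∨ u = 1 := by
  revert u; decide

theorem bitSign_add (u v : ZMod 2) : bitSign (u + v) = bitSign u * bitSign v := by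
  have h : (1 : ZMod 2) + 1 = 0 := by decide
  rcases bit_eq_zero_or_one u with rfl | rfl <;> rcases bit_eq_zero_or_one v with rfl | rfl <;>
    simp [bitSign_zero, bitSign_one, h]

theorem bitSign_mul_self (u : ZMod 2) : bitSign u * bitSign u = 1 := by
  rcases bit_eq_zero_or_one u with rfl | rfl <;> simp [bitSign_zero, bitSign_one]

theorem minSumF_neg_left (a b : ℝ) : minSumF (-a) b = -minSumF a b := by
  simp [minSumF, Real.sign_neg]

theorem minSumF_neg_right (a b : ℝ) : minSumF a (-b) = -minSumF a b := by
  simp [minSumF, Real.sign_neg]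

theorem minSumF_bitSign (u v : ZMod 2) (a b : ℝ) :
    minSumF (bitSign u * a) (bitSign v * b) = bitSign (u + v) * minSumF a b := by
  rw [bitSign_add]
  rcases bit_eq_zero_or_one u with rfl | rfl <;> rcases bit_eq_zero_or_one v with rfl | rfl <;>
    simp [bitSign_zero, bitSign_one, minSumF_neg_left, minSumF_neg_right]

/-- With u the even and v the odd bit, the first half carries the sign of u + v; the factor (-1)^u
cancels u, leaving the common sign of v. -/
theorem gFun_bitSign (u v : ZMod 2) (a b : ℝ) :
    gFun u (bitSign (u + v) * a) (bitSign v * b) = bitSign v * (a + b) := by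
  change bitSign u * (bitSign (u + v) * a) + bitSign v * b = _
  rw [bitSign_add]
  linear_combination (bitSign v * a) * bitSign_mul_self u

variable {Y : Type*}

/-- Apply the symmetry `σ` at the positions where the codeword `x` is `1`. -/
def twist {ι : Type*} (σ : Y → Y) (x : ι → ZMod 2) (y : ι → Y) : ι → Y :=
  fun k => if x k = 0 then y k else σ (y k)

theorem firstHalf_twist (σ : Y → Y) (n : ℕ) (u : Fin (2 ^ (n + 1)) → ZMod 2)
    (y : Fin (2 ^ (n + 1)) → Y) :
    firstHalf (twist σ (polarTransform (n + 1) u) y) =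
      twist σ (polarTransform n (evens u + odds u)) (firstHalf y) := by
  funext k
  simp [firstHalf, twist, polarTransform]

theorem secondHalf_twist (σ : Y → Y) (n : ℕ) (u : Fin (2 ^ (n + 1)) → ZMod 2)
    (y : Fin (2 ^ (n + 1)) → Y) :
    secondHalf (twist σ (polarTransform (n + 1) u) y) =
      twist σ (polarTransform n (odds u)) (secondHalf y) := by
  funext k
  simp [secondHalf, twist, polarTransform]

theorem evens_zero (n : ℕ) : evens (0 : Fin (2 ^ (n + 1)) → ZMod 2) = 0 := rfl

theorem odds_zero (n : ℕ) : odds (0 : Fin (2 ^ (n + 1)) → ZMod 2) = 0 := rfl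

theorem polarTransform_zero (n : ℕ) : polarTransform n 0 = 0 := by
  induction n with
  | zero => rfl
  | succ n ih =>
    funext k
    simp [polarTransform, evens_zero, odds_zero, ih]

theorem minSumLabel_zero_succ (lab : Y → ℝ) (n : ℕ) (i : Fin (2 ^ (n + 1)))
    (y : Fin (2 ^ (n + 1)) → Y) :
    minSumLabel lab (n + 1) i y 0 =
      if (i : ℕ) % 2 = 0 then
        minSumF (minSumLabel lab n (halfIndex i) (firstHalf y) 0)
          (minSumLabel lab n (halfIndex i) (secondHalf y) 0)
      else minSumLabel lab n (halfIndex i) (firstHalf y) 0 +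
        minSumLabel lab n (halfIndex i) (secondHalf y) 0 := by
  simp [minSumLabel, evens_zero, odds_zero, gFun]

/-- The label for the bits `u` and the twisted outputs is, up to the sign of `u i`, the label for
the zero word and the untwisted outputs. -/
theorem minSumLabel_twist {σ : Y → Y} {lab : Y → ℝ} (h : ∀ y, lab (σ y) = -lab y) (n : ℕ)
    (i : Fin (2 ^ n)) (y : Fin (2 ^ n) → Y) (u : Fin (2 ^ n) → ZMod 2) :
    minSumLabel lab n i (twist σ (polarTransform n u) y) u =
      bitSign (u i) * minSumLabel lab n i y 0 := by
  induction n with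
  | zero =>
    obtain rfl : i = 0 := Fin.fin_one_eq_zero i
    simp only [minSumLabel, twist, polarTransform]
    rcases bit_eq_zero_or_one (u 0) with hu | hu <;> simp [hu, bitSign_zero, bitSign_one, h]
  | succ n ih =>
    rw [minSumLabel_zero_succ]
    simp only [minSumLabel, firstHalf_twist, secondHalf_twist, ih, Pi.add_apply]
    split_ifs with hi
    · rw [minSumF_bitSign]
      -- The two halves carry the signs of (even + odd) and odd; over GF(2) their product is the
      -- sign of the even bit.
      have h2 : odds u (halfIndex i) + odds u (halfIndex i) = 0 := CharTwo.add_self_eq_zero _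
      have h3 : evens u (halfIndex i) = u i := by
        simp only [evens, halfIndex]
        congr 1
        ext
        simp only
        omega
      rw [add_assoc, h2, add_zero, h3]
    · have h3 : evens u (halfIndex i) = u ⟨i - 1, by have := i.2; omega⟩ := by
        simp only [evens, halfIndex]
        congr 1
        ext
        simp only
        omega
      have h4 : odds u (halfIndex i) = u i := by
        simp only [odds, halfIndex]
        congr 1
        ext
        simp only
        omega
      rw [← h3, gFun_bitSign, h4]

end Symmetry

/-! ### The label law under the zero word -/

section Law

variable {Y : Type*} [MeasurableSpace Y]

theorem measurable_minSumF : Measurable fun p : ℝ × ℝ => minSumF p.1 p.2 := by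
  have hs : Measurable Real.sign := by
    unfold Real.sign
    exact Measurable.ite measurableSet_Iio measurable_const
      (Measurable.ite measurableSet_Ioi measurable_const measurable_const)
  unfold minSumF
  exact ((hs.comp measurable_fst).mul (hs.comp measurable_snd)).mul
    (measurable_fst.abs.min measurable_snd.abs)

theorem measurable_firstHalf (n : ℕ) :
    Measurable (firstHalf : (Fin (2 ^ (n + 1)) → Y) → Fin (2 ^ n) → Y) :=
  measurable_pi_lambda _ fun _ => measurable_pi_apply _

theorem measurable_secondHalf (n : ℕ) :
    Measurable (secondHalf : (Fin (2 ^ (n + 1)) → Y) → Fin (2 ^ n) → Y) :=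
  measurable_pi_lambda _ fun _ => measurable_pi_apply _

theorem measurable_minSumLabel {lab : Y → ℝ} (hlab : Measurable lab) (n : ℕ) (i : Fin (2 ^ n))
    (u : Fin (2 ^ n) → ZMod 2) : Measurable fun y => minSumLabel lab n i y u := by
  induction n with
  | zero => exact hlab.comp (measurable_pi_apply 0)
  | succ n ih =>
    have ha := (ih (halfIndex i) (evens u + odds u)).comp (measurable_firstHalf (Y := Y) n)
    have hb := (ih (halfIndex i) (odds u)).comp (measurable_secondHalf (Y := Y) n)
    simp only [minSumLabel]
    split_ifs
    · exact measurable_minSumF.comp (ha.prodMk hb)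
    · exact (ha.const_mul _).add hb

theorem measurable_twist {ι : Type*} {σ : Y → Y} (hσ : Measurable σ) (x : ι → ZMod 2) :
    Measurable (twist σ x) := by
  refine measurable_pi_lambda _ fun k => ?_
  unfold twist
  split_ifs
  · exact measurable_pi_apply k
  · exact hσ.comp (measurable_pi_apply k)

theorem outputLaw_zero (W : ZMod 2 → Measure Y) (n : ℕ) : outputLaw W n 0 = Measure.pi fun _ => W 0 := by
  simp [outputLaw, polarTransform_zero]

variable (W : ZMod 2 → Measure Y) [∀ x, IsProbabilityMeasure (W x)]

instance (n : ℕ) (u : Fin (2 ^ n) → ZMod 2) : IsProbabilityMeasure (outputLaw W n u) := by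
  unfold outputLaw; infer_instance

theorem outputLaw_eq_map_twist {σ : Y → Y} (hσ : IsChannelSymmetry W σ) (n : ℕ)
    (u : Fin (2 ^ n) → ZMod 2) :
    outputLaw W n u = (outputLaw W n 0).map (twist σ (polarTransform n u)) := by
  rw [outputLaw_zero, outputLaw]
  have hm : ∀ k : Fin (2 ^ n),
      Measurable fun y : Y => if polarTransform n u k = 0 then y else σ y := by
    intro k
    split_ifs
    · exact measurable_id
    · exact hσ.measurable
  have hk : ∀ k : Fin (2 ^ n),
      (W 0).map (fun y : Y => if polarTransform n u k = 0 then y else σ y) =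
        W (polarTransform n u k) := by
    intro k
    rcases bit_eq_zero_or_one (polarTransform n u k) with h | h
    · simp [h]
    · simp only [h, one_ne_zero, if_false]
      exact hσ.map_eq
  have : ∀ k : Fin (2 ^ n), SigmaFinite ((W 0).map
      (fun y : Y => if polarTransform n u k = 0 then y else σ y)) := by
    intro k
    rw [hk]
    infer_instance
  have := Measure.pi_map_pi (μ := fun _ : Fin (2 ^ n) => W 0)
    (f := fun k y => if polarTransform n u k = 0 then y else σ y) (fun k => (hm k).aemeasurable)
  simp only [hk] at this
  exact this.symm

/-- The law of the label of index `i` when the zero word is sent. -/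
noncomputable def labelLaw (lab : Y → ℝ) (n : ℕ) (i : Fin (2 ^ n)) : Measure ℝ :=
  (outputLaw W n 0).map fun y => minSumLabel lab n i y 0

/-- Sending u instead of 0 amounts to twisting the outputs, which changes the label only by the sign
of u i. -/
theorem map_minSumLabel {σ : Y → Y} (hσ : IsChannelSymmetry W σ) {lab : Y → ℝ}
    (hlab : IsFairLabeler W σ lab) (n : ℕ) (i : Fin (2 ^ n)) (u : Fin (2 ^ n) → ZMod 2) :
    (outputLaw W n u).map (fun y => bitSign (u i) * minSumLabel lab n i y u) =
      labelLaw W lab n i := by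
  rw [outputLaw_eq_map_twist W hσ n u, Measure.map_map
    ((measurable_minSumLabel hlab.measurable n i u).const_mul _) (measurable_twist hσ.measurable _)]
  unfold labelLaw
  congr 1
  funext y
  simp only [Function.comp, minSumLabel_twist hlab.symm]
  rw [← mul_assoc, bitSign_mul_self, one_mul]

theorem card_filter_apply_eq {ι : Type*} [Fintype ι] [DecidableEq ι] (i : ι) (b : ZMod 2) :
    2 * (Finset.univ.filter fun u : ι → ZMod 2 => u i = b).card = 2 ^ Fintype.card ι := by
  have h := Fintype.card_filter_piFinset_const_eq_of_mem (Finset.univ : Finset (ZMod 2)) i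
    (Finset.mem_univ b)
  rw [Fintype.piFinset_univ] at h
  rw [h]
  have : 0 < Fintype.card ι := Fintype.card_pos_iff.2 ⟨i⟩
  rw [Finset.card_univ, ZMod.card, ← pow_succ']
  congr 1
  omega

/-- Half of the 2^N words have u i = 0, and each contributes 2^(-N) times the same label law. The
factor 2 in `Zxi` thus restores a probability measure. -/
theorem two_mul_synthDist {σ : Y → Y} (hσ : IsChannelSymmetry W σ) {lab : Y → ℝ}
    (hlab : IsFairLabeler W σ lab) (n : ℕ) (i : Fin (2 ^ n)) :
    (2 : ℝ≥0∞) • synthDist W lab n i 0 = labelLaw W lab n i := by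
  have h : synthDist W lab n i 0 = ∑ u : Fin (2 ^ n) → ZMod 2 with u i = 0,
      ((2 : ℝ≥0∞) ^ (2 ^ n))⁻¹ • labelLaw W lab n i := by
    refine Finset.sum_congr rfl fun u hu => ?_
    have hu' : u i = 0 := (Finset.mem_filter.1 hu).2
    have := map_minSumLabel W hσ hlab n i u
    simp only [hu', bitSign_zero, one_mul] at this
    rw [this]
  have hc := card_filter_apply_eq i (0 : ZMod 2)
  rw [Fintype.card_fin] at hc
  have hc' : (2 : ℝ≥0∞) * ((Finset.univ.filter fun u : Fin (2 ^ n) → ZMod 2 => u i = 0).card : ℝ≥0∞)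
      = 2 ^ 2 ^ n := by exact_mod_cast congrArg (Nat.cast : ℕ → ℝ≥0∞) hc
  rw [h, Finset.sum_const, ← Nat.cast_smul_eq_nsmul ℝ≥0∞, smul_smul, smul_smul, hc',
    ENNReal.mul_inv_cancel (by simp) (by simp), one_smul]

theorem Zxi_synthDist {σ : Y → Y} (hσ : IsChannelSymmetry W σ) {lab : Y → ℝ}
    (hlab : IsFairLabeler W σ lab) (n : ℕ) (i : Fin (2 ^ n)) (ξ : ℝ) :
    Zxi (synthDist W lab n i 0) ξ = ∫⁻ t, ENNReal.ofReal (ξ ^ t) ∂labelLaw W lab n i := by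
  rw [← two_mul_synthDist W hσ hlab, lintegral_smul_measure, Zxi, smul_eq_mul]

/-- The two halves of the output of the zero word are independent copies. -/
theorem map_halves (n : ℕ) :
    (outputLaw W (n + 1) 0).map (fun y => (firstHalf y, secondHalf y)) =
      (outputLaw W n 0).prod (outputLaw W n 0) := by
  simp only [outputLaw_zero]
  let e : Fin (2 ^ n) ⊕ Fin (2 ^ n) ≃ Fin (2 ^ (n + 1)) :=
    finSumFinEquiv.trans (finCongr (by rw [pow_succ]; omega))
  have h1 := measurePreserving_piCongrLeft (α := fun _ => Y) (fun _ => W 0) e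
  have h2 := measurePreserving_sumPiEquivProdPi_symm (X := fun _ : Fin (2 ^ n) ⊕ Fin (2 ^ n) => Y)
    (fun _ => W 0)
  have h3 := (h1.comp h2).map_eq
  rw [← h3, Measure.map_map]
  · convert Measure.map_id
    refine funext fun p => Prod.ext ?_ ?_
    · funext k
      have : (⟨k, by have := k.2; rw [pow_succ]; omega⟩ : Fin (2 ^ (n + 1))) = e (Sum.inl k) := by
        ext; simp [e]
      simp only [Function.comp, firstHalf, this]
      exact Equiv.piCongrLeft_apply_apply (fun _ => Y) e _ (Sum.inl k)
    · funext k
      have : (⟨2 ^ n + k, by have := k.2; rw [pow_succ]; omega⟩ : Fin (2 ^ (n + 1))) =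
          e (Sum.inr k) := by
        ext; simp [e, add_comm]
      simp only [Function.comp, secondHalf, this]
      exact Equiv.piCongrLeft_apply_apply (fun _ => Y) e _ (Sum.inr k)
  · exact (measurable_firstHalf n).prodMk (measurable_secondHalf n)
  · exact (h1.comp h2).measurable

/-- Density evolution: the halves are independent copies under the zero word, and with previous bit
0 the function `gFun` is plain addition. -/
theorem labelLaw_succ {lab : Y → ℝ} (hlab : Measurable lab) (n : ℕ) (i : Fin (2 ^ (n + 1))) :
    labelLaw W lab (n + 1) i =
      ((labelLaw W lab n (halfIndex i)).prod (labelLaw W lab n (halfIndex i))).map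
        fun p => if (i : ℕ) % 2 = 0 then minSumF p.1 p.2 else p.1 + p.2 := by
  have hm := measurable_minSumLabel hlab n (halfIndex i) 0
  have hg : Measurable fun p : ℝ × ℝ => if (i : ℕ) % 2 = 0 then minSumF p.1 p.2 else p.1 + p.2 := by
    split_ifs
    · exact measurable_minSumF
    · exact measurable_fst.add measurable_snd
  unfold labelLaw
  rw [Measure.map_prod_map _ _ hm hm, ← map_halves, Measure.map_map (hm.prodMap hm)
    ((measurable_firstHalf n).prodMk (measurable_secondHalf n)), Measure.map_map hg]
  · congr 1
    funext y
    rw [minSumLabel_zero_succ]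
    rfl
  · exact (hm.prodMap hm).comp ((measurable_firstHalf n).prodMk (measurable_secondHalf n))

end Law

/-! ### Evolution of the optimized parameter -/

section Zstar

/-- The infimum over `0 < ξ ≤ 1` of the integral of `ξ ^ t`. -/
noncomputable def zInf (μ : Measure ℝ) : ℝ≥0∞ :=
  ⨅ ξ ∈ Set.Ioc (0 : ℝ) 1, ∫⁻ t, ENNReal.ofReal (ξ ^ t) ∂μ

theorem zInf_le (μ : Measure ℝ) {ξ : ℝ} (hξ : ξ ∈ Set.Ioc (0 : ℝ) 1) :
    zInf μ ≤ ∫⁻ t, ENNReal.ofReal (ξ ^ t) ∂μ := iInf₂_le ξ hξ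

theorem zInf_ne_top (μ : Measure ℝ) [IsProbabilityMeasure μ] : zInf μ ≠ ⊤ := by
  refine ne_top_of_le_ne_top ENNReal.one_ne_top ((zInf_le μ (ξ := 1) (by simp)).trans ?_)
  simp

theorem measurable_ofReal_rpow {ξ : ℝ} (hξ : 0 < ξ) :
    Measurable fun t : ℝ => ENNReal.ofReal (ξ ^ t) :=
  (Real.continuous_const_rpow hξ.ne').measurable.ennreal_ofReal

/-- Only opposite signs need an argument: the value is then -min |a| |b|, which is no smaller than
the negative one of the two. -/
theorem min_le_minSumF (a b : ℝ) : min a b ≤ minSumF a b := by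
  unfold minSumF
  rcases lt_trichotomy a 0 with ha | rfl | ha <;> rcases lt_trichotomy b 0 with hb | rfl | hb
  · rw [Real.sign_of_neg ha, Real.sign_of_neg hb, abs_of_neg ha, abs_of_neg hb]
    have h1 : 0 < min (-a) (-b) := lt_min (by linarith) (by linarith)
    have h2 := min_le_left a b
    linarith
  · simp [ha.le]
  · rw [Real.sign_of_neg ha, Real.sign_of_pos hb, abs_of_neg ha, abs_of_pos hb,
      min_eq_left (by linarith)]
    have := min_le_left (-a) b
    linarith
  · simp [hb.le]
  · simp
  · simp [hb.le]
  · rw [Real.sign_of_pos ha, Real.sign_of_neg hb, abs_of_pos ha, abs_of_neg hb,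
      min_eq_right (by linarith)]
    have := min_le_right a (-b)
    linarith
  · simp [ha.le]
  · rw [Real.sign_of_pos ha, Real.sign_of_pos hb, abs_of_pos ha, abs_of_pos hb]
    linarith

theorem zInf_map_minSumF_le (μ : Measure ℝ) [IsProbabilityMeasure μ] :
    zInf ((μ.prod μ).map fun p => minSumF p.1 p.2) ≤ 2 * zInf μ := by
  -- The factor 2 is moved across so that the infimum on the right can be tested one ξ at a time.
  rw [mul_comm, ← ENNReal.div_le_iff (by norm_num) (by norm_num)]
  refine le_iInf₂ fun ξ hξ => ?_
  rw [ENNReal.div_le_iff (by norm_num) (by norm_num)]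
  have hm := measurable_ofReal_rpow hξ.1
  refine (zInf_le _ hξ).trans ?_
  rw [lintegral_map hm measurable_minSumF]
  calc ∫⁻ p : ℝ × ℝ, ENNReal.ofReal (ξ ^ minSumF p.1 p.2) ∂μ.prod μ
      ≤ ∫⁻ p : ℝ × ℝ, (ENNReal.ofReal (ξ ^ p.1) + ENNReal.ofReal (ξ ^ p.2)) ∂μ.prod μ := by
        refine lintegral_mono fun p => ?_
        have h := Real.rpow_le_rpow_of_exponent_ge hξ.1 hξ.2 (min_le_minSumF p.1 p.2)
        refine (ENNReal.ofReal_le_ofReal h).trans ?_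
        rcases min_choice p.1 p.2 with h | h <;> rw [h]
        · exact le_self_add
        · exact le_add_self
    _ = (∫⁻ t, ENNReal.ofReal (ξ ^ t) ∂μ) + ∫⁻ t, ENNReal.ofReal (ξ ^ t) ∂μ := by
        rw [lintegral_add_left (show Measurable fun p : ℝ × ℝ => ENNReal.ofReal (ξ ^ p.1) from
          hm.comp measurable_fst)]
        congr 1
        · exact measurePreserving_fst.lintegral_comp hm
        · exact measurePreserving_snd.lintegral_comp hm
    _ = _ := (mul_two _).symm

theorem zInf_map_add_le (μ : Measure ℝ) [IsProbabilityMeasure μ] :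
    zInf ((μ.prod μ).map fun p => p.1 + p.2) ≤ zInf μ ^ 2 := by
  -- Taking a square root frees the infimum from the square; the same ξ then serves both independent
  -- factors.
  have key : zInf ((μ.prod μ).map fun p => p.1 + p.2) ^ ((2 : ℝ)⁻¹) ≤ zInf μ := by
    refine le_iInf₂ fun ξ hξ => ?_
    rw [ENNReal.rpow_inv_le_iff (by norm_num)]
    have hm := measurable_ofReal_rpow hξ.1
    refine (zInf_le _ hξ).trans_eq ?_
    rw [lintegral_map hm (show Measurable fun p : ℝ × ℝ => p.1 + p.2 from
      measurable_fst.add measurable_snd)]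
    have e : ∀ p : ℝ × ℝ, ENNReal.ofReal (ξ ^ (p.1 + p.2)) =
        ENNReal.ofReal (ξ ^ p.1) * ENNReal.ofReal (ξ ^ p.2) := fun p => by
      rw [Real.rpow_add hξ.1, ENNReal.ofReal_mul (Real.rpow_nonneg hξ.1.le _)]
    simp only [e]
    rw [lintegral_prod_mul hm.aemeasurable hm.aemeasurable, ENNReal.rpow_ofNat, sq]
  rw [ENNReal.rpow_inv_le_iff (by norm_num)] at key
  simpa using key

/-- Chernoff bound: ξ^t ≥ 1 whenever t ≤ 0 and 0 < ξ ≤ 1. -/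
theorem measure_Iic_le_zInf (μ : Measure ℝ) : μ (Set.Iic 0) ≤ zInf μ := by
  refine le_iInf₂ fun ξ hξ => ?_
  rw [← lintegral_indicator_one measurableSet_Iic]
  refine lintegral_mono fun t => ?_
  by_cases ht : t ∈ Set.Iic (0 : ℝ)
  · rw [Set.indicator_of_mem ht]
    simpa using Real.one_le_rpow_of_pos_of_le_one_of_nonpos hξ.1 hξ.2 ht
  · rw [Set.indicator_of_notMem ht]
    exact zero_le

theorem Zstar_nonneg (Q : Measure ℝ) : 0 ≤ Zstar Q := ENNReal.toReal_nonneg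

variable {Y : Type*} [MeasurableSpace Y]

/-- `Zstar` of the synthetic distributions, with natural number indices. -/
noncomputable def zNat (W : ZMod 2 → Measure Y) (lab : Y → ℝ) (n i : ℕ) : ℝ :=
  if h : i < 2 ^ n then Zstar (synthDist W lab n ⟨i, h⟩ 0) else 0

theorem zNat_coe (W : ZMod 2 → Measure Y) (lab : Y → ℝ) (n : ℕ) (i : Fin (2 ^ n)) :
    zNat W lab n i = Zstar (synthDist W lab n i 0) := by
  simp [zNat]

theorem zNat_nonneg (W : ZMod 2 → Measure Y) (lab : Y → ℝ) (n i : ℕ) : 0 ≤ zNat W lab n i := by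
  unfold zNat
  split_ifs
  · exact Zstar_nonneg _
  · exact le_rfl

variable {W : ZMod 2 → Measure Y} [∀ x, IsProbabilityMeasure (W x)]
  {σ : Y → Y} {lab : Y → ℝ}

theorem isProbabilityMeasure_labelLaw (hlab : Measurable lab) (n : ℕ) (i : Fin (2 ^ n)) :
    IsProbabilityMeasure (labelLaw W lab n i) :=
  Measure.isProbabilityMeasure_map (measurable_minSumLabel hlab n i 0).aemeasurable

theorem Zstar_synthDist (hσ : IsChannelSymmetry W σ) (hlab : IsFairLabeler W σ lab) (n : ℕ)
    (i : Fin (2 ^ n)) : Zstar (synthDist W lab n i 0) = (zInf (labelLaw W lab n i)).toReal := by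
  simp only [Zstar, zInf, Zxi_synthDist W hσ hlab]

theorem Zstar_succ_even_le (hσ : IsChannelSymmetry W σ) (hlab : IsFairLabeler W σ lab) {n : ℕ}
    {i : Fin (2 ^ (n + 1))} (hi : (i : ℕ) % 2 = 0) :
    Zstar (synthDist W lab (n + 1) i 0) ≤ 2 * Zstar (synthDist W lab n (halfIndex i) 0) := by
  have := isProbabilityMeasure_labelLaw (W := W) hlab.measurable n (halfIndex i)
  rw [Zstar_synthDist hσ hlab, Zstar_synthDist hσ hlab, labelLaw_succ W hlab.measurable]
  simp only [hi, if_true]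
  have h := ENNReal.toReal_mono (ENNReal.mul_ne_top (by norm_num) (zInf_ne_top _))
    (zInf_map_minSumF_le (labelLaw W lab n (halfIndex i)))
  simpa using h

theorem Zstar_succ_odd_le (hσ : IsChannelSymmetry W σ) (hlab : IsFairLabeler W σ lab) {n : ℕ}
    {i : Fin (2 ^ (n + 1))} (hi : (i : ℕ) % 2 = 1) :
    Zstar (synthDist W lab (n + 1) i 0) ≤ Zstar (synthDist W lab n (halfIndex i) 0) ^ 2 := by
  have := isProbabilityMeasure_labelLaw (W := W) hlab.measurable n (halfIndex i)
  rw [Zstar_synthDist hσ hlab, Zstar_synthDist hσ hlab, labelLaw_succ W hlab.measurable]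
  simp only [hi, one_ne_zero, if_false]
  have h := ENNReal.toReal_mono (ENNReal.pow_ne_top (zInf_ne_top _))
    (zInf_map_add_le (labelLaw W lab n (halfIndex i)))
  simpa using h

/-- The recursion for `zeta` replaces the two step inequalities by equalities, both monotone in the
nonnegative parent value; at vertices of G it restarts from the exact value. -/
theorem Zstar_le_zeta (hσ : IsChannelSymmetry W σ) (hlab : IsFairLabeler W σ lab)
    (G : Finset Vertex) (d : ℕ) (j : Fin (2 ^ d)) :
    Zstar (synthDist W lab d j 0) ≤ zeta W lab G d j := by
  induction d with
  | zero => exact le_rfl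
  | succ d ih =>
    rw [zeta]
    split_ifs with h1 h2
    · exact le_rfl
    · exact (Zstar_succ_even_le hσ hlab h2).trans (by linarith [ih (halfIndex j)])
    · exact (Zstar_succ_odd_le hσ hlab (by omega)).trans
        (pow_le_pow_left₀ (Zstar_nonneg _) (ih _) 2)

theorem zNat_left_le (hσ : IsChannelSymmetry W σ) (hlab : IsFairLabeler W σ lab) (n j : ℕ) :
    zNat W lab (n + 1) (2 * j) ≤ 2 * zNat W lab n j := by
  by_cases h : j < 2 ^ n
  · have h' : 2 * j < 2 ^ (n + 1) := by rw [pow_succ]; omega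
    have := Zstar_succ_even_le hσ hlab (i := ⟨2 * j, h'⟩) (by simp)
    simpa [zNat, h, h', halfIndex] using this
  -- Outside the index range parent and child are both out of range, so both sides vanish.
  · have h' : ¬ 2 * j < 2 ^ (n + 1) := by rw [pow_succ]; omega
    simp only [zNat, h, h', dif_neg, not_false_eq_true, mul_zero, le_refl]

theorem zNat_right_le (hσ : IsChannelSymmetry W σ) (hlab : IsFairLabeler W σ lab) (n j : ℕ) :
    zNat W lab (n + 1) (2 * j + 1) ≤ zNat W lab n j ^ 2 := by
  by_cases h : j < 2 ^ n
  · have h' : 2 * j + 1 < 2 ^ (n + 1) := by rw [pow_succ]; omega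
    have := Zstar_succ_odd_le hσ hlab (i := ⟨2 * j + 1, h'⟩) (by simp)
    have e : (2 * j + 1) / 2 = j := by omega
    simpa [zNat, h, h', halfIndex, e] using this
  · have h' : ¬ 2 * j + 1 < 2 ^ (n + 1) := by rw [pow_succ]; omega
    simp [zNat, h, h']

end Zstar

/-! ### The union bound for the decoder -/

section Decoder

variable {Y : Type*}

/-- As long as the earlier decisions are correct, the label computed from them is the one computed
from the true bits. Strict positivity matters because a zero label is decided as 0. -/
theorem scDecode_eq_of_forall {lab : Y → ℝ} {n : ℕ} {A : Finset (Fin (2 ^ n))}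
    {y : Fin (2 ^ n) → Y} {u : Fin (2 ^ n) → ZMod 2} (hu : ∀ i, i ∉ A → u i = 0)
    (h : ∀ i ∈ A, 0 < bitSign (u i) * minSumLabel lab n i y u) : scDecode lab n A y = u := by
  have key : ∀ k, ∀ i : Fin (2 ^ n), (i : ℕ) < k → scDecodeAux lab n A y k i = u i := by
    intro k
    induction k with
    | zero => intro i hi; omega
    | succ k ih =>
      intro i hi
      by_cases hk : k < 2 ^ n
      · rw [scDecodeAux, dif_pos hk]
        rcases Nat.lt_succ_iff_lt_or_eq.1 hi with hlt | heq
        · rw [Function.update_of_ne (by rw [Ne, Fin.ext_iff]; exact hlt.ne)]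
          exact ih i hlt
        · obtain rfl : i = ⟨k, hk⟩ := Fin.ext heq
          rw [Function.update_self, minSumLabel_congr lab n ⟨k, hk⟩ y _ u
            (fun l hl => ih l hl)]
          by_cases hA : (⟨k, hk⟩ : Fin (2 ^ n)) ∈ A
          · have hpos := h _ hA
            rcases bit_eq_zero_or_one (u ⟨k, hk⟩) with hb | hb <;>
              rw [hb] at hpos ⊢ <;> simp only [bitSign_zero, bitSign_one] at hpos
            · rw [if_neg (fun hc => by linarith [hc.2])]
            · rw [if_pos ⟨hA, by linarith⟩]
          · rw [if_neg (fun hc => hA hc.1), hu _ hA]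
      · rw [scDecodeAux, dif_neg hk]
        exact ih i (by have := i.2; omega)
  funext i
  exact key _ i i.2

theorem card_codewords_le {ι : Type*} [Fintype ι] [DecidableEq ι] (A : Finset ι) :
    (Finset.univ.filter fun u : ι → ZMod 2 => ∀ i, i ∉ A → u i = 0).card ≤ 2 ^ A.card := by
  rw [← Finset.card_powerset]
  refine Finset.card_le_card_of_injOn (fun u => Finset.univ.filter fun i => u i = 1) ?_ ?_
  · intro u hu
    rw [Finset.mem_coe, Finset.mem_filter] at hu
    rw [Finset.mem_coe, Finset.mem_powerset]
    intro i hi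
    rw [Finset.mem_filter] at hi
    by_contra hA
    rw [hu.2 i hA] at hi
    exact zero_ne_one hi.2
  · intro u _ v _ huv
    funext i
    have h : u i = 1 ↔ v i = 1 := by simpa using Finset.ext_iff.1 huv i
    rcases bit_eq_zero_or_one (u i) with h1 | h1 <;> rcases bit_eq_zero_or_one (v i) with h2 | h2 <;>
      simp_all

variable [MeasurableSpace Y] {W : ZMod 2 → Measure Y} [∀ x, IsProbabilityMeasure (W x)]
  {σ : Y → Y} {lab : Y → ℝ}

theorem measure_label_nonpos_le (hσ : IsChannelSymmetry W σ) (hlab : IsFairLabeler W σ lab) (n : ℕ)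
    (i : Fin (2 ^ n)) (u : Fin (2 ^ n) → ZMod 2) :
    (outputLaw W n u).real {y | bitSign (u i) * minSumLabel lab n i y u ≤ 0} ≤
      Zstar (synthDist W lab n i 0) := by
  have := isProbabilityMeasure_labelLaw (W := W) hlab.measurable n i
  rw [Zstar_synthDist hσ hlab, Measure.real]
  refine ENNReal.toReal_mono (zInf_ne_top _) (le_trans (le_of_eq ?_) (measure_Iic_le_zInf _))
  rw [← map_minSumLabel W hσ hlab n i u, Measure.map_apply
    ((measurable_minSumLabel hlab.measurable n i u).const_mul _) measurableSet_Iic]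
  rfl

theorem measure_scDecode_ne_le (hσ : IsChannelSymmetry W σ) (hlab : IsFairLabeler W σ lab) (n : ℕ)
    (A : Finset (Fin (2 ^ n))) {u : Fin (2 ^ n) → ZMod 2} (hu : ∀ i, i ∉ A → u i = 0) :
    (outputLaw W n u).real {y | scDecode lab n A y ≠ u} ≤
      ∑ i ∈ A, Zstar (synthDist W lab n i 0) := by
  have hsub : {y | scDecode lab n A y ≠ u} ⊆
      ⋃ i ∈ A, {y | bitSign (u i) * minSumLabel lab n i y u ≤ 0} := by
    intro y hy
    by_contra hc
    simp only [Set.mem_iUnion, Set.mem_ofPred_eq, not_exists, not_le] at hc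
    exact hy (scDecode_eq_of_forall hu hc)
  calc _ ≤ (outputLaw W n u).real (⋃ i ∈ A, {y | bitSign (u i) * minSumLabel lab n i y u ≤ 0}) :=
        measureReal_mono hsub (measure_ne_top _ _)
    _ ≤ ∑ i ∈ A, (outputLaw W n u).real {y | bitSign (u i) * minSumLabel lab n i y u ≤ 0} :=
        measureReal_biUnion_finset_le _ _
    _ ≤ _ := Finset.sum_le_sum fun i _ => measure_label_nonpos_le hσ hlab n i u

theorem wordErrorProb_le (hσ : IsChannelSymmetry W σ) (hlab : IsFairLabeler W σ lab) (n : ℕ)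
    (A : Finset (Fin (2 ^ n))) :
    wordErrorProb W lab n A ≤ ∑ i ∈ A, Zstar (synthDist W lab n i 0) := by
  have h := Finset.sum_le_card_nsmul
    (Finset.univ.filter fun u : Fin (2 ^ n) → ZMod 2 => ∀ i, i ∉ A → u i = 0)
    (fun u => (outputLaw W n u).real {y | scDecode lab n A y ≠ u}) _
    (fun u hu => measure_scDecode_ne_le hσ hlab n A (Finset.mem_filter.1 hu).2)
  rw [nsmul_eq_mul] at h
  have hc : ((Finset.univ.filter fun u : Fin (2 ^ n) → ZMod 2 => ∀ i, i ∉ A → u i = 0).card : ℝ) ≤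
      2 ^ A.card := by exact_mod_cast card_codewords_le A
  have hS : 0 ≤ ∑ i ∈ A, Zstar (synthDist W lab n i 0) :=
    Finset.sum_nonneg fun i _ => Zstar_nonneg _
  have h2 := h.trans (mul_le_mul_of_nonneg_right hc hS)
  rw [wordErrorProb, one_div, inv_mul_le_iff₀ (by positivity)]
  exact h2

end Decoder

/-! ### The threshold -/

section Threshold

variable {Y : Type*} [MeasurableSpace Y] {W : ZMod 2 → Measure Y} [∀ x, IsProbabilityMeasure (W x)]
  {σ : Y → Y} {lab : Y → ℝ}

theorem exists_code (hσ : IsChannelSymmetry W σ) (hlab : IsFairLabeler W σ lab)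
    {G E : Finset Vertex} (hGE : IsValidPair G E) {β : ℝ} (hβ0 : 0 < β) (hβ : β < 1 / 2) {R : ℝ}
    (hR : R < RL W lab G E) :
    ∃ n₀ : ℕ, ∀ n : ℕ, n₀ ≤ n → ∃ A : Finset (Fin (2 ^ n)),
      R ≤ codeRate n A ∧ wordErrorProb W lab n A ≤ (2 : ℝ) ^ (-((2 : ℝ) ^ n) ^ β) := by
  obtain ⟨T, hT, hE, -, -⟩ := hGE
  -- Each leaf may lose ε; the `+ 1` keeps the total loss below the gap and avoids division by zero.
  set ε : ℝ := (RL W lab G E - R) / (E.card + 1) with hεdef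
  have hε : 0 < ε := div_pos (by linarith) (by positivity)
  have hev : ∀ᶠ n : ℕ in Filter.atTop, ∀ v ∈ E, v.1 ≤ n ∧
      (1 / 2 ^ v.1) * (max (1 - deltaPrime (zeta W lab G v.1 v.2)) 0 - ε) ≤
      (((descendants (n - v.1) v.2).filter fun i =>
        zNat W lab n i ≤ (2 : ℝ) ^ (-((2 : ℝ) ^ n) ^ β) / 2 ^ n).card : ℝ) / 2 ^ n := by
    rw [Filter.eventually_all_finset]
    intro v _
    exact eventually_card_good_descendants (zNat_nonneg W lab) (zNat_left_le hσ hlab)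
      (zNat_right_le hσ hlab) hβ0 hβ (by rw [zNat_coe]; exact Zstar_le_zeta hσ hlab G v.1 v.2) hε
  obtain ⟨n₀, hn₀⟩ := Filter.eventually_atTop.1 hev
  refine ⟨n₀, fun n hn => ?_⟩
  have hleaf := hn₀ n hn
  set τ : ℝ := (2 : ℝ) ^ (-((2 : ℝ) ^ n) ^ β) / 2 ^ n with hτ
  -- All sufficiently reliable indices are used; at most N of them, each with parameter at most
  -- 2^(-N^β)/N, make the union bound work.
  let A : Finset (Fin (2 ^ n)) := Finset.univ.filter fun i => Zstar (synthDist W lab n i 0) ≤ τ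
  have hN : (0 : ℝ) < 2 ^ n := by positivity
  have hτ0 : 0 < τ := by positivity
  refine ⟨A, ?_, ?_⟩
  · let S : Vertex → Finset ℕ := fun v =>
      (descendants (n - v.1) v.2).filter fun i => zNat W lab n i ≤ τ
    -- Good indices below different leaves are distinct: a common descendant would place one leaf in
    -- or below the other.
    have hdisj : Set.PairwiseDisjoint (E : Set Vertex) S := by
      have aux : ∀ v ∈ E, ∀ w ∈ E, v.1 ≤ w.1 → ¬ Disjoint (S v) (S w) → v = w := by
        intro v hv w hw hle hnd
        obtain ⟨i, hi1, hi2⟩ := Finset.not_disjoint_iff.1 hnd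
        have h1 := mem_descendants.1 (Finset.mem_filter.1 hi1).1
        have h2 := mem_descendants.1 (Finset.mem_filter.1 hi2).1
        refine hT.eq_of_leaf_of_le ((hE v).1 hv).2.1 ((hE w).1 hw).1 hle ?_
        rw [← h1, ← h2, Nat.div_div_eq_div_mul, ← pow_add]
        congr 2
        have := (hleaf w hw).1
        omega
      intro v hv w hw hne
      by_contra hnd
      rcases le_total v.1 w.1 with hle | hle
      · exact hne (aux v hv w hw hle hnd)
      · exact hne (aux w hw v hv hle fun h => hnd h.symm).symm
    have hcard : (E.biUnion S).card ≤ A.card := by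
      rw [← Finset.card_map Fin.valEmbedding (s := A)]
      refine Finset.card_le_card fun i hi => ?_
      obtain ⟨v, hv, hi⟩ := Finset.mem_biUnion.1 hi
      obtain ⟨hi1, hi2⟩ := Finset.mem_filter.1 hi
      have hlt : i < 2 ^ n := by
        rw [mem_descendants] at hi1
        have h1 := v.2.2
        rw [← hi1, Nat.div_lt_iff_lt_mul (by positivity), ← pow_add] at h1
        rwa [Nat.add_sub_cancel' (hleaf v hv).1] at h1
      refine Finset.mem_map.2 ⟨⟨i, hlt⟩, Finset.mem_filter.2 ⟨Finset.mem_univ _, ?_⟩, rfl⟩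
      rw [← zNat_coe]
      exact hi2
    rw [Finset.card_biUnion hdisj] at hcard
    have hcard' : (∑ v ∈ E, ((S v).card : ℝ)) ≤ A.card := by exact_mod_cast hcard
    have hsum : RL W lab G E - E.card * ε ≤ ∑ v ∈ E, ((S v).card : ℝ) / 2 ^ n := by
      rw [RL, ← nsmul_eq_mul, ← Finset.sum_const, ← Finset.sum_sub_distrib]
      refine Finset.sum_le_sum fun v hv => le_trans ?_ (hleaf v hv).2
      have h1 : (1 / 2 ^ v.1 : ℝ) ≤ 1 := by
        rw [div_le_one (by positivity)]
        exact one_le_pow₀ (by norm_num)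
      nlinarith
    have hεE : (E.card + 1) * ε = RL W lab G E - R := by
      rw [hεdef]
      field_simp
    rw [← Finset.sum_div] at hsum
    rw [codeRate]
    have := div_le_div_of_nonneg_right hcard' hN.le
    linarith
  · refine (wordErrorProb_le hσ hlab n A).trans ?_
    have h := Finset.sum_le_card_nsmul A (fun i => Zstar (synthDist W lab n i 0)) τ
      (fun i hi => (Finset.mem_filter.1 hi).2)
    rw [nsmul_eq_mul] at h
    have hA : (A.card : ℝ) ≤ 2 ^ n := by
      have := Finset.card_le_univ A
      rw [Fintype.card_fin] at this
      exact_mod_cast this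
    refine h.trans ((mul_le_mul_of_nonneg_right hA hτ0.le).trans_eq ?_)
    rw [hτ]
    field_simp

end Threshold

end MinSumPolar

theorem mainTheorem7 {Y : Type*} [MeasurableSpace Y]
    (W : ZMod 2 → Measure Y) [∀ x, IsProbabilityMeasure (W x)]
    (σ : Y → Y) (hσ : IsChannelSymmetry W σ)
    (lab : Y → ℝ) (hlab : IsFairLabeler W σ lab)
    (G E : Finset Vertex) (hGE : IsValidPair G E) :
    (∀ β : ℝ, 0 < β → β < 1 / 2 → ∀ R : ℝ, R < RL W lab G E →
      ∃ n₀ : ℕ, ∀ n : ℕ, n₀ ≤ n → ∃ A : Finset (Fin (2 ^ n)),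
        R ≤ codeRate n A ∧
        wordErrorProb W lab n A ≤ (2 : ℝ) ^ (-((2 : ℝ) ^ n) ^ β)) ∧
    (∀ U : ℝ, IsUpperThreshold W lab U → RL W lab G E ≤ U) := by
  refine ⟨fun β hβ0 hβ R hR => exists_code hσ hlab hGE hβ0 hβ hR, fun U hU => ?_⟩
  by_contra! hlt
  -- At a rate strictly between, one and the same code would have error at most 2^(-N^(1/4)) ≤ 1/2
  -- and at least 3/4; the exponent 1/4 is an arbitrary choice in (0, 1/2).
  obtain ⟨R, hUR, hR⟩ := exists_between hlt
  obtain ⟨n₀, h₀⟩ := exists_code hσ hlab hGE (β := 1 / 4) (by norm_num) (by norm_num) hR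
  obtain ⟨n₁, h₁⟩ := hU R hUR (1 / 4) (by norm_num)
  obtain ⟨A, hA, herr⟩ := h₀ (max n₀ n₁) (le_max_left _ _)
  have hbig := h₁ (max n₀ n₁) (le_max_right _ _) A hA
  have hN : (1 : ℝ) ≤ ((2 : ℝ) ^ (max n₀ n₁)) ^ (1 / 4 : ℝ) :=
    Real.one_le_rpow (one_le_pow₀ (by norm_num)) (by norm_num)
  have hhalf : (2 : ℝ) ^ (-((2 : ℝ) ^ (max n₀ n₁)) ^ (1 / 4 : ℝ)) ≤ (2 : ℝ) ^ (-1 : ℝ) :=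
    Real.rpow_le_rpow_of_exponent_le (by norm_num) (by linarith)
  rw [Real.rpow_neg_one] at hhalf
  linarith
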